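/- For integers $r\ge 0$ and $b\ge1$ let $$c_0\left(\frac rb\right)=-\sum_{m=1}^{b-1}\frac mb\cot\left(\frac{\pi m r}{b}\right),$$ and for $x\in\mathbb R$ let $$g(x)=\sum_{l\ge1}\frac{1-2\{lx\}}{l}=\lim_{N\to\infty}\sum_{l=1}^{N}\frac{1-2\{lx\}}{l},$$ where $\{u\}$ is the fractional part of $u$ (the limit exists for almost every $x$). Let $(H_k)_{k\ge0}$ be either the sequence of integrals $$H_k=\int_0^1\left(\frac{g(x)}{\pi}\right)^{2k}dx,$$ or, for some fixed real numbers $A_0,A_1$ with $1/2<A_0<A_1<1$, the sequence of limiting moments $$H_k=\lim_{b\to\infty}\frac{1}{\phi(b)\,b^{2k}\,(A_1-A_0)}\sum_{\substack{A_0b\le r\le A_1b\\ (r,b)=1}}c_0\left(\frac rb\right)^{2k},$$ where $\phi$ is Euler's function (for the second reading, $(H_k)$ is any real sequence for which these limit relations hold for all $k\ge 0$). Then the series $$\sum_{k\ge0}\frac{H_k}{(2k)!}\,x^k$$ diverges for every $x\in\mathbb C$ with $|x|>\pi^2$; consequently its radius of convergence is at most $\pi^2$, and in particular it is finite. -/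

import Mathlib

open Filter Topology

namespace CotangentMoments

noncomputable section

/-- The cotangent sum `c₀(r/b) = -∑_{m=1}^{b-1} (m/b) cot(π m r / b)`. -/
def cotSum (r b : ℕ) : ℝ :=
  -∑ m ∈ Finset.Ico 1 b, ((m : ℝ) / b) * Real.cot (Real.pi * m * r / b)

open Classical in
/-- The residues `r` with `(r,b) = 1` and `A₀ b ≤ r ≤ A₁ b` (here `A₁ < 1`, so `r ≤ b`). -/
def residues (A₀ A₁ : ℝ) (b : ℕ) : Finset ℕ :=
  (Finset.range (b + 1)).filter fun r => r.Coprime b ∧ A₀ * b ≤ r ∧ (r : ℝ) ≤ A₁ * b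

/-- The normalized `2k`-th moment of the cotangent sums with denominator `b`. -/
def normalizedMoment (A₀ A₁ : ℝ) (k b : ℕ) : ℝ :=
  (Nat.totient b : ℝ)⁻¹ * ((b : ℝ) ^ (2 * k))⁻¹ * (A₁ - A₀)⁻¹ *
    ∑ r ∈ residues A₀ A₁ b, cotSum r b ^ (2 * k)

/-- `H` is the sequence of limiting moments of the cotangent sums:
`H k = lim_{b → ∞} φ(b)⁻¹ b^{-2k} (A₁ - A₀)⁻¹ ∑ c₀(r/b)^{2k}` for every `k`. -/
def IsLimitMoments (A₀ A₁ : ℝ) (H : ℕ → ℝ) : Prop :=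
  ∀ k, Tendsto (normalizedMoment A₀ A₁ k) atTop (𝓝 (H k))

/-- `g(x) = ∑_{l ≥ 1} (1 - 2{l x}) / l`. The series converges only conditionally (for almost
every `x`), so its sum is the limit of the partial sums and not a `tsum`. -/
def g (x : ℝ) : ℝ :=
  limUnder atTop fun N : ℕ => ∑ l ∈ Finset.Icc 1 N, (1 - 2 * Int.fract ((l : ℝ) * x)) / l

/-- The moments as integrals, `∫₀¹ (g(x)/π)^{2k} dx`. -/
def integralMoment (k : ℕ) : ℝ :=
  ∫ x in (0 : ℝ)..1, (g x / Real.pi) ^ (2 * k)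

/-- The coefficients `H_k / (2k)!` of the power series. -/
def coeff (H : ℕ → ℝ) (k : ℕ) : ℂ :=
  ((H k / (Nat.factorial (2 * k) : ℝ) : ℝ) : ℂ)

/-- The series `∑_{k ≥ 0} H_k x^k / (2k)!` diverges: its partial sums have no limit in `ℂ`. -/
def SeriesDiverges (H : ℕ → ℝ) (x : ℂ) : Prop :=
  ¬ ∃ s : ℂ, Tendsto (fun n : ℕ => ∑ k ∈ Finset.range n, coeff H k * x ^ k) atTop (𝓝 s)

/-- The radius of convergence of `∑_{k ≥ 0} H_k x^k / (2k)!`. -/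
def seriesRadius (H : ℕ → ℝ) : ENNReal :=
  (FormalMultilinearSeries.ofScalars ℂ (coeff H)).radius

end

end CotangentMoments

/-!
Both moment sequences satisfy `H k ≥ ((log M - 3) / π) ^ (2 k) / (4 M)` for every `M` with
`log M > 3`. Multiplying by `|x| ^ k / (2 k)!` and summing gives
`cosh (√|x| (log M - 3) / π) / (4 M)`, which is unbounded in `M` as soon as `√|x| > π`.

For the integrals, the terms `(1 - 2 {l x}) / l` of `g` have nonnegative integral over
`[0, 1 / M]`, and those with `l ≤ M` contribute about `(log M) / M` in total; Jensen's inequality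
then bounds the even moments below. The series may be integrated termwise because its blocks
`n² < l ≤ (n + 1)²` are summable in every `Lᵖ`, `p < ∞`, by the bound `(l, m)² / (l m)` for the
correlations of `{l x}` and `{m x}`.

For the limiting moments, `(π / b) c₀(r / b)` is a function of the inverse `s` of `r` modulo `b`
whose average over `0 ≤ s < b / M` is about `log M`, by the same computation on a discrete
interval. Along `b = q²` with `q` prime, inversion is affine on each class modulo `q`, so the
exponential sums over the inverses of the `r` in an interval reduce to geometric sums. They are
`O(q log q)`, and the inverses are equidistributed well enough to restrict the moment to the `r`
with `0 ≤ s < b / M` and apply Jensen's inequality there.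
-/

namespace CotangentMoments

open MeasureTheory

/-- The lower bound for the moments that drives the divergence of the series: a function of size at
least `(log M - 3) / π` on a set of measure about `1 / M` has such moments. -/
def HasLogLowerBound (H : ℕ → ℝ) : Prop :=
  ∀ k M : ℕ, 3 < Real.log M → ((Real.log M - 3) / Real.pi) ^ (2 * k) / (4 * M) ≤ H k

theorem tendsto_log_natCast_atTop : Tendsto (fun M : ℕ => Real.log M) atTop atTop :=
  Real.tendsto_log_atTop.comp tendsto_natCast_atTop_atTop

theorem pos_of_log_natCast_pos {M : ℕ} (hM : 0 < Real.log M) : 0 < M :=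
  Nat.pos_of_ne_zero fun h => by simp [h] at hM

theorem HasLogLowerBound.nonneg {H : ℕ → ℝ} (hH : HasLogLowerBound H) (k : ℕ) : 0 ≤ H k := by
  obtain ⟨M, hM⟩ := (tendsto_log_natCast_atTop.eventually_gt_atTop 3).exists
  have := (even_two_mul k).pow_nonneg ((Real.log M - 3) / Real.pi)
  exact le_trans (by positivity) (hH k M hM)

theorem HasLogLowerBound.cosh_div_le_tsum {H : ℕ → ℝ} (hH : HasLogLowerBound H) {r : ℝ}
    (hr : 0 ≤ r) (hs : Summable fun k => H k / (2 * k).factorial * r ^ k) {M : ℕ}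
    (hM : 3 < Real.log M) :
    Real.cosh ((Real.log M - 3) / Real.pi * √r) / (4 * M) ≤
      ∑' k, H k / (2 * k).factorial * r ^ k := by
  refine hasSum_le (fun k => ?_) ((Real.hasSum_cosh _).div_const _) hs.hasSum
  calc ((Real.log M - 3) / Real.pi * √r) ^ (2 * k) / (2 * k).factorial / (4 * M)
      = ((Real.log M - 3) / Real.pi) ^ (2 * k) / (4 * M) / (2 * k).factorial * r ^ k := by
        rw [mul_pow, pow_mul (√r), Real.sq_sqrt hr]
        ring
    _ ≤ H k / (2 * k).factorial * r ^ k := by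
        gcongr
        exact hH k M hM

theorem HasLogLowerBound.not_summable {H : ℕ → ℝ} (hH : HasLogLowerBound H) {r : ℝ}
    (hr : Real.pi ^ 2 < r) : ¬ Summable fun k => H k / (2 * k).factorial * r ^ k := by
  intro hs
  set S := ∑' k, H k / (2 * k).factorial * r ^ k
  set a := √r / Real.pi with ha
  have ha1 : 1 < a := by
    rw [ha, one_lt_div Real.pi_pos]
    exact Real.lt_sqrt_of_sq_lt hr
  have hlim : Tendsto (fun M : ℕ => Real.exp ((a - 1) * Real.log M + -(3 * a))) atTop atTop :=
    Real.tendsto_exp_atTop.comp <| tendsto_atTop_add_const_right _ _ <|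
      tendsto_log_natCast_atTop.const_mul_atTop (sub_pos.mpr ha1)
  obtain ⟨M, hMS, hM⟩ := ((hlim.eventually_gt_atTop (8 * S)).and
    (tendsto_log_natCast_atTop.eventually_gt_atTop 3)).exists
  have hM0 : (0 : ℝ) < M := Nat.cast_pos.mpr (pos_of_log_natCast_pos (by linarith))
  have hexp : Real.exp ((Real.log M - 3) / Real.pi * √r) / 2 ≤
      Real.cosh ((Real.log M - 3) / Real.pi * √r) := by
    rw [Real.cosh_eq]
    gcongr
    exact le_add_of_nonneg_right (Real.exp_pos _).le
  have hS := hH.cosh_div_le_tsum ((sq_nonneg _).trans hr.le) hs hM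
  refine absurd hMS (not_lt.mpr ?_)
  calc Real.exp ((a - 1) * Real.log M + -(3 * a))
      = 8 * (Real.exp ((Real.log M - 3) / Real.pi * √r) / 2 / (4 * M)) := by
        rw [show (a - 1) * Real.log M + -(3 * a) =
          (Real.log M - 3) / Real.pi * √r - Real.log M by rw [ha]; ring, Real.exp_sub,
          Real.exp_log hM0]
        ring
    _ ≤ 8 * S := by
        gcongr
        exact le_trans (by gcongr) hS

theorem HasLogLowerBound.seriesRadius_le {H : ℕ → ℝ} (hH : HasLogLowerBound H) :
    seriesRadius H ≤ ENNReal.ofReal (Real.pi ^ 2) := by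
  refine ENNReal.le_of_forall_nnreal_lt fun r hr => ?_
  by_contra! hlt
  have hpr : Real.pi ^ 2 < r := by
    rwa [← ENNReal.ofReal_coe_nnreal, ENNReal.ofReal_lt_ofReal_iff_of_nonneg (by positivity)] at hlt
  refine hH.not_summable hpr
    ((FormalMultilinearSeries.summable_norm_mul_pow _ hr).congr fun k => ?_)
  rw [FormalMultilinearSeries.ofScalars_norm, coeff, Complex.norm_of_nonneg]
  exact div_nonneg (hH.nonneg k) (Nat.cast_nonneg _)

theorem seriesDiverges_of_seriesRadius_lt {H : ℕ → ℝ} {x : ℂ}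
    (hx : seriesRadius H < ENNReal.ofReal ‖x‖) : SeriesDiverges H x := by
  rintro ⟨s, hs⟩
  have hterm : Tendsto (fun k => coeff H k * x ^ k) atTop (𝓝 0) := by
    simpa [Function.comp_def, Finset.sum_range_succ] using
      (hs.comp (tendsto_add_atTop_nat 1)).sub hs
  refine hx.not_ge ?_
  rw [ofReal_norm]
  refine FormalMultilinearSeries.le_radius_of_tendsto _ (l := 0) ?_
  simpa [FormalMultilinearSeries.ofScalars_norm] using hterm.norm

theorem HasLogLowerBound.seriesDiverges {H : ℕ → ℝ} (hH : HasLogLowerBound H) {x : ℂ}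
    (hx : Real.pi ^ 2 < ‖x‖) : SeriesDiverges H x :=
  seriesDiverges_of_seriesRadius_lt <| hH.seriesRadius_le.trans_lt <|
    (ENNReal.ofReal_lt_ofReal_iff_of_nonneg (by positivity)).mpr hx

theorem card_mul_pow_le_sum_pow {ι : Type*} {s : Finset ι} {f : ι → ℝ} {c : ℝ} (hc : 0 ≤ c)
    (h : s.card * c ≤ ∑ i ∈ s, f i) {n : ℕ} (hn : Even n) :
    s.card * c ^ n ≤ ∑ i ∈ s, f i ^ n := by
  rcases s.eq_empty_or_nonempty with rfl | hs
  · simp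
  have hs0 : (0 : ℝ) < s.card := by exact_mod_cast hs.card_pos
  have hmean : c ≤ ∑ i ∈ s, (s.card : ℝ)⁻¹ * f i := by
    rwa [← Finset.mul_sum, le_inv_mul_iff₀ hs0]
  have hjensen := Real.pow_arith_mean_le_arith_mean_pow_of_even s (fun _ => (s.card : ℝ)⁻¹) f
    (fun _ _ => by positivity) (by simp [hs0.ne']) hn
  rw [← Finset.mul_sum _ fun i => f i ^ n] at hjensen
  rw [← le_inv_mul_iff₀ hs0]
  exact (pow_le_pow_left₀ hc hmean n).trans hjensen

theorem measureReal_mul_pow_le_integral_pow {α : Type*} [MeasurableSpace α]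
    {μ : Measure α} [IsFiniteMeasure μ] {f : α → ℝ} {n : ℕ}
    (hf : Integrable f μ) (hfn : Integrable (fun x => f x ^ n) μ)
    {c : ℝ} (hc : 0 ≤ c) (h : μ.real Set.univ * c ≤ ∫ x, f x ∂μ) (hn : Even n) :
    μ.real Set.univ * c ^ n ≤ ∫ x, f x ^ n ∂μ := by
  rcases eq_zero_or_neZero μ with rfl | hμ
  · simp
  have hμ0 : 0 < μ.real Set.univ := measureReal_univ_pos
  have hmean : c ≤ ⨍ x, f x ∂μ := by
    rwa [average_eq, smul_eq_mul, le_inv_mul_iff₀ hμ0]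
  have hjensen := (hn.convexOn_pow (𝕜 := ℝ)).map_average_le (continuous_pow n).continuousOn
    isClosed_univ (Eventually.of_forall fun x => Set.mem_univ (f x)) hf hfn
  rw [average_eq _ fun x => f x ^ n, smul_eq_mul] at hjensen
  rw [← le_inv_mul_iff₀ hμ0]
  exact (pow_le_pow_left₀ hc hmean n).trans hjensen

/-! ### Correlations of sawtooth functions -/

theorem sum_range_natCast_zmod {E : Type*} [AddCommMonoid E] (l : ℕ) [NeZero l] (F : ZMod l → E) :
    ∑ j ∈ Finset.range l, F (j : ZMod l) = ∑ z, F z :=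
  Finset.sum_bij' (fun j _ => (j : ZMod l)) (fun z _ => z.val) (by simp)
    (fun z _ => Finset.mem_range.mpr z.val_lt)
    (fun _ hj => ZMod.val_cast_of_lt (Finset.mem_range.mp hj)) (by simp) (by simp)

theorem periodic_apply_val_div {E : Type*} {f : ℝ → E} (hf : Function.Periodic f 1) (l : ℕ)
    [NeZero l] (n : ℕ) : f (((n : ZMod l).val : ℝ) / l) = f (n / l) := by
  have hl : (l : ℝ) ≠ 0 := NeZero.ne _
  have hn : (n : ℝ) = (n % l : ℕ) + l * (n / l : ℕ) := by
    exact_mod_cast (Nat.mod_add_div n l).symm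
  rw [ZMod.val_natCast, hn, add_div, mul_div_cancel_left₀ _ hl]
  simpa using (hf.nat_mul (n / l) (((n % l : ℕ) : ℝ) / l)).symm

theorem sum_periodic_mul_div {E : Type*} [AddCommMonoid E] {f : ℝ → E}
    (hf : Function.Periodic f 1) {l m : ℕ} (hl : 0 < l) (hlm : m.Coprime l) :
    ∑ j ∈ Finset.range l, f (m * j / l) = ∑ j ∈ Finset.range l, f (j / l) := by
  have : NeZero l := ⟨hl.ne'⟩
  have hu : IsUnit (m : ZMod l) := (ZMod.isUnit_iff_coprime m l).mpr hlm
  calc ∑ j ∈ Finset.range l, f (m * j / l)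
      = ∑ j ∈ Finset.range l, f ((((m : ZMod l) * (j : ZMod l)).val : ℝ) / l) := by
        refine Finset.sum_congr rfl fun j _ => ?_
        rw [← Nat.cast_mul, ← Nat.cast_mul, periodic_apply_val_div hf]
    _ = ∑ z : ZMod l, f ((((m : ZMod l) * z).val : ℝ) / l) :=
        sum_range_natCast_zmod l fun z => f ((((m : ZMod l) * z).val : ℝ) / l)
    _ = ∑ z : ZMod l, f ((z.val : ℝ) / l) :=
        Equiv.sum_comp (Units.mulLeft hu.unit) fun z : ZMod l => f ((z.val : ℝ) / l)
    _ = ∑ j ∈ Finset.range l, f (j / l) := by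
        rw [← sum_range_natCast_zmod l]
        exact Finset.sum_congr rfl fun j _ => periodic_apply_val_div hf l j

/-- The sawtooth function `x ↦ 1 - 2{x}`, the terms of the series `g` being `saw (l x) / l`. -/
noncomputable def saw (x : ℝ) : ℝ := 1 - 2 * Int.fract x

theorem abs_saw_le_one (x : ℝ) : |saw x| ≤ 1 := by
  have h1 := Int.fract_nonneg x
  have h2 := Int.fract_lt_one x
  rw [saw, abs_le]
  constructor <;> linarith

theorem saw_periodic : Function.Periodic saw 1 := fun x => by simp [saw]

theorem saw_add_natCast (x : ℝ) (n : ℕ) : saw (x + n) = saw x := by simp [saw]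

theorem measurable_saw : Measurable saw := by
  unfold saw
  fun_prop

theorem saw_of_mem_Ico {x : ℝ} (hx : x ∈ Set.Ico (0 : ℝ) 1) : saw x = 1 - 2 * x := by
  rw [saw, Int.fract_eq_self.mpr hx]

theorem sum_saw_add_div_of_lt {l : ℕ} (hl : 0 < l) {y : ℝ} (hy : 0 ≤ y) (hly : l * y < 1) :
    ∑ j ∈ Finset.range l, saw (y + j / l) = saw (l * y) := by
  have hl' : (0 : ℝ) < l := by exact_mod_cast hl
  have hterm : ∀ j ∈ Finset.range l, saw (y + j / l) = 1 - 2 * y - 2 / l * j := by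
    intro j hj
    have hj' : (j : ℝ) + 1 ≤ l := by exact_mod_cast Finset.mem_range.mp hj
    rw [saw_of_mem_Ico]
    · ring
    · refine ⟨by positivity, ?_⟩
      rw [← mul_lt_mul_iff_right₀ hl', mul_add, mul_div_cancel₀ _ hl'.ne']
      linarith
  have hgauss : (∑ j ∈ Finset.range l, (j : ℝ)) * 2 = l * (l - 1) := by
    have h := congrArg (Nat.cast (R := ℝ)) (Finset.sum_range_id_mul_two l)
    rwa [Nat.cast_mul, Nat.cast_mul, Nat.cast_sum, Nat.cast_pred hl, Nat.cast_two] at h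
  rw [Finset.sum_congr rfl hterm, saw_of_mem_Ico ⟨by positivity, hly⟩, Finset.sum_sub_distrib,
    ← Finset.mul_sum, Finset.sum_const, Finset.card_range, nsmul_eq_mul, div_mul_eq_mul_div,
    mul_comm 2 (Finset.sum _ _), hgauss, mul_div_cancel_left₀ _ hl'.ne']
  ring

theorem periodic_sum_add_div {E : Type*} [AddCommGroup E] {f : ℝ → E}
    (hf : Function.Periodic f 1) (l : ℕ) :
    Function.Periodic (fun y => ∑ j ∈ Finset.range l, f (y + j / l)) (1 / l) := by
  intro y
  rcases l.eq_zero_or_pos with rfl | hl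
  · simp
  have hl' : (l : ℝ) ≠ 0 := by exact_mod_cast hl.ne'
  have hends : f (y + (l : ℝ) / l) = f (y + ((0 : ℕ) : ℝ) / l) := by simp [div_self hl', hf y]
  have hshift := (Finset.sum_range_succ (fun j : ℕ => f (y + j / l)) l).symm.trans
    (Finset.sum_range_succ' (fun j : ℕ => f (y + j / l)) l)
  rw [hends] at hshift
  refine Eq.trans (Finset.sum_congr rfl fun j _ => ?_) (add_right_cancel hshift).symm
  congr 1
  push_cast
  ring

theorem sum_saw_add_div {l : ℕ} (hl : 0 < l) (y : ℝ) :
    ∑ j ∈ Finset.range l, saw (y + j / l) = saw (l * y) := by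
  have hl' : (0 : ℝ) < l := by exact_mod_cast hl
  have hsaw : Function.Periodic (fun y => saw (l * y)) (1 / l) := fun y => by
    simp only [mul_add, mul_one_div_cancel hl'.ne', saw_periodic _]
  obtain ⟨y', hy', hyy'⟩ := ((periodic_sum_add_div saw_periodic l).sub hsaw).exists_mem_Ico₀
    (by positivity) y
  have hly' : l * y' < 1 := by
    rw [mul_comm]
    exact (lt_div_iff₀ hl').mp hy'.2
  simpa [sub_eq_zero, sum_saw_add_div_of_lt hl hy'.1 hly'] using hyy'

theorem sum_saw_add_mul_div {l m : ℕ} (hl : 0 < l) (hlm : m.Coprime l) (y : ℝ) :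
    ∑ j ∈ Finset.range l, saw (y + m * j / l) = saw (l * y) := by
  have hper : Function.Periodic (fun t => saw (y + t)) 1 := fun t => by
    simp only [← add_assoc, saw_periodic _]
  rw [sum_periodic_mul_div hper hl hlm, sum_saw_add_div hl]

theorem intervalIntegrable_of_measurable_of_abs_le {f : ℝ → ℝ} (hf : Measurable f) {C : ℝ}
    (hC : ∀ x, |f x| ≤ C) (a b : ℝ) : IntervalIntegrable f volume a b := by
  rw [intervalIntegrable_iff]
  exact Measure.integrableOn_of_bounded (M := C) (by simp)
    hf.aestronglyMeasurable (Eventually.of_forall hC)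

theorem integral_comp_natCast_mul {f : ℝ → ℝ} (hf : Function.Periodic f 1)
    (hint : ∀ a b, IntervalIntegrable f volume a b) {d : ℕ} (hd : 0 < d) :
    ∫ x in (0 : ℝ)..1, f (d * x) = ∫ x in (0 : ℝ)..1, f x := by
  have hd' : (d : ℝ) ≠ 0 := by exact_mod_cast hd.ne'
  have hperiods := hf.intervalIntegral_add_zsmul_eq d 0 hint
  simp only [zero_add, zsmul_eq_mul, mul_one, Int.cast_natCast] at hperiods
  rw [intervalIntegral.integral_comp_mul_left _ hd', mul_zero, mul_one, hperiods, smul_eq_mul,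
    inv_mul_cancel_left₀ hd']

theorem integral_comp_add_of_periodic {f : ℝ → ℝ} (hf : Function.Periodic f 1) (c : ℝ) :
    ∫ x in (0 : ℝ)..1, f (x + c) = ∫ x in (0 : ℝ)..1, f x := by
  rw [intervalIntegral.integral_comp_add_right, zero_add, add_comm 1 c,
    hf.intervalIntegral_add_eq c 0, zero_add]

theorem saw_mul_periodic (l : ℕ) : Function.Periodic (fun x => saw (l * x)) 1 := fun x => by
  simp only [mul_add, mul_one, saw_add_natCast]

theorem measurable_saw_mul (l : ℝ) : Measurable fun x => saw (l * x) :=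
  measurable_saw.comp (measurable_const_mul l)

theorem abs_saw_mul_saw_le_one (x y : ℝ) : |saw x * saw y| ≤ 1 := by
  rw [abs_mul]
  exact mul_le_one₀ (abs_saw_le_one x) (abs_nonneg _) (abs_saw_le_one y)

theorem intervalIntegrable_saw_mul_saw_add (l m c a b : ℝ) :
    IntervalIntegrable (fun x => saw (l * x) * saw (m * x + c)) volume a b :=
  intervalIntegrable_of_measurable_of_abs_le
    ((measurable_saw_mul l).mul (measurable_saw.comp (by fun_prop)))
    (fun _ => abs_saw_mul_saw_le_one _ _) a b

theorem intervalIntegrable_saw_mul_saw (l m a b : ℝ) :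
    IntervalIntegrable (fun x => saw (l * x) * saw (m * x)) volume a b := by
  simpa using intervalIntegrable_saw_mul_saw_add l m 0 a b

/- Averaging over the translations by `j / l`, which leave `saw (l x)` unchanged, replaces
`saw (m x)` by `saw (l m x) / l`. -/
theorem integral_saw_mul_saw_of_coprime {l m : ℕ} (hl : 0 < l) (hlm : m.Coprime l) :
    ∫ x in (0 : ℝ)..1, saw (l * x) * saw (m * x) =
      (∫ x in (0 : ℝ)..1, saw x * saw (m * x)) / l := by
  have hl' : (l : ℝ) ≠ 0 := by exact_mod_cast hl.ne'
  have htranslate : ∀ j : ℕ, ∫ x in (0 : ℝ)..1, saw (l * x) * saw (m * x + m * j / l) =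
      ∫ x in (0 : ℝ)..1, saw (l * x) * saw (m * x) := by
    intro j
    refine Eq.trans (intervalIntegral.integral_congr fun x _ => ?_) <|
      integral_comp_add_of_periodic ((saw_mul_periodic l).mul (saw_mul_periodic m)) ((j : ℝ) / l)
    simp only [Pi.mul_apply, mul_add, mul_div_cancel₀ _ hl', saw_add_natCast, mul_div_assoc]
  rw [eq_div_iff hl']
  calc (∫ x in (0 : ℝ)..1, saw (l * x) * saw (m * x)) * l
      = ∑ j ∈ Finset.range l, ∫ x in (0 : ℝ)..1, saw (l * x) * saw (m * x + m * j / l) := by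
        rw [Finset.sum_congr rfl fun j _ => htranslate j, Finset.sum_const, Finset.card_range,
          nsmul_eq_mul, mul_comm]
    _ = ∫ x in (0 : ℝ)..1, ∑ j ∈ Finset.range l, saw (l * x) * saw (m * x + m * j / l) := by
        rw [intervalIntegral.integral_finsetSum fun j _ =>
          intervalIntegrable_saw_mul_saw_add l m _ 0 1]
    _ = ∫ x in (0 : ℝ)..1, saw (l * x) * saw (m * (l * x)) := by
        refine intervalIntegral.integral_congr fun x _ => ?_
        simp only [← Finset.mul_sum, sum_saw_add_mul_div hl hlm, mul_left_comm]
    _ = ∫ x in (0 : ℝ)..1, saw x * saw (m * x) :=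
        integral_comp_natCast_mul (f := fun x => saw x * saw (m * x))
          (saw_periodic.mul (saw_mul_periodic m))
          (fun a b => by simpa using intervalIntegrable_saw_mul_saw 1 m a b) hl

theorem abs_integral_saw_mul_saw_le_of_coprime {l m : ℕ} (hl : 0 < l) (hm : 0 < m)
    (hlm : m.Coprime l) :
    |∫ x in (0 : ℝ)..1, saw (l * x) * saw (m * x)| ≤ 1 / (l * m) := by
  have hdiag : |∫ x in (0 : ℝ)..1, saw x * saw x| ≤ 1 := by
    simpa using intervalIntegral.norm_integral_le_of_norm_le_const (a := 0) (b := 1)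
      (f := fun x => saw x * saw x) fun x _ => abs_saw_mul_saw_le_one x x
  have hone := integral_saw_mul_saw_of_coprime (l := m) (m := 1) hm m.coprime_one_left
  simp only [Nat.cast_one, one_mul] at hone
  rw [integral_saw_mul_saw_of_coprime hl hlm]
  simp only [mul_comm (saw _) (saw ((m : ℝ) * _)), hone]
  rw [div_div, abs_div, abs_of_nonneg (by positivity : (0 : ℝ) ≤ m * l), mul_comm (m : ℝ)]
  gcongr

theorem abs_integral_saw_mul_saw_le {l m : ℕ} (hl : 0 < l) (hm : 0 < m) :
    |∫ x in (0 : ℝ)..1, saw (l * x) * saw (m * x)| ≤ (Nat.gcd l m : ℝ) ^ 2 / (l * m) := by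
  obtain ⟨d, l', m', hd, hco, rfl, rfl⟩ := Nat.exists_coprime' (Nat.gcd_pos_of_pos_left m hl)
  have hd' : (d : ℝ) ≠ 0 := by exact_mod_cast hd.ne'
  have hscale : ∫ x in (0 : ℝ)..1, saw ((l' * d : ℕ) * x) * saw ((m' * d : ℕ) * x) =
      ∫ x in (0 : ℝ)..1, saw (l' * x) * saw (m' * x) := by
    simp only [Nat.cast_mul, mul_assoc]
    exact integral_comp_natCast_mul (f := fun x => saw (l' * x) * saw (m' * x))
      ((saw_mul_periodic l').mul (saw_mul_periodic m')) (intervalIntegrable_saw_mul_saw _ _) hd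
  rw [Nat.gcd_mul_right, hco.gcd_eq_one, one_mul, hscale]
  refine (abs_integral_saw_mul_saw_le_of_coprime (Nat.pos_of_mul_pos_right hl)
    (Nat.pos_of_mul_pos_right hm) hco.symm).trans_eq ?_
  push_cast
  field_simp

/-! ### The function `g` -/

/-- Lebesgue measure on the unit interval. -/
noncomputable abbrev unitMeasure : Measure ℝ := volume.restrict (Set.Ioc 0 1)

instance : IsProbabilityMeasure unitMeasure := ⟨by simp⟩

/-- The block `n ^ 2 < l ≤ (n + 1) ^ 2` of the series defining `g`. Grouped into these blocks the
series converges absolutely almost everywhere. -/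
noncomputable def sawBlock (n : ℕ) (x : ℝ) : ℝ :=
  ∑ l ∈ Finset.Ioc (n ^ 2) ((n + 1) ^ 2), saw (l * x) / l

theorem measurable_sawBlock (n : ℕ) : Measurable (sawBlock n) :=
  Finset.measurable_fun_sum _ fun l _ => (measurable_saw_mul l).div_const _

theorem card_Ioc_sq (n : ℕ) : (Finset.Ioc (n ^ 2) ((n + 1) ^ 2)).card = 2 * n + 1 := by
  rw [Nat.card_Ioc, add_sq, mul_one, one_pow, add_assoc, Nat.add_sub_cancel_left]

theorem succ_sq_le_two_mul {n l : ℕ} (hl : n ^ 2 < l) : ((n : ℝ) + 1) ^ 2 ≤ 2 * l := by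
  have hl' : (n : ℝ) ^ 2 + 1 ≤ l := by exact_mod_cast hl
  linarith [sq_nonneg ((n : ℝ) - 1), show ((n : ℝ) + 1) ^ 2 + (n - 1) ^ 2 = 2 * (n ^ 2 + 1) by ring]

theorem abs_sum_saw_div_le {n : ℕ} {s : Finset ℕ} (hs : s ⊆ Finset.Ioc (n ^ 2) ((n + 1) ^ 2))
    (x : ℝ) : |∑ l ∈ s, saw (l * x) / l| ≤ 4 / (n + 1) := by
  have hterm : ∀ l ∈ s, |saw (l * x) / l| ≤ 2 / ((n : ℝ) + 1) ^ 2 := by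
    intro l hl
    have hl' := succ_sq_le_two_mul (Finset.mem_Ioc.mp (hs hl)).1
    have hl0 : (0 : ℝ) < l := by nlinarith [n.cast_nonneg (α := ℝ)]
    rw [abs_div, Nat.abs_cast, div_le_div_iff₀ hl0 (by positivity)]
    nlinarith [abs_saw_le_one (l * x), sq_nonneg ((n : ℝ) + 1)]
  have hcard : (s.card : ℝ) ≤ 2 * (n + 1) := by
    have := (Finset.card_le_card hs).trans_eq (card_Ioc_sq n)
    exact_mod_cast this.trans (by omega)
  calc |∑ l ∈ s, saw (l * x) / l| ≤ ∑ l ∈ s, 2 / ((n : ℝ) + 1) ^ 2 :=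
        (Finset.abs_sum_le_sum_abs _ _).trans (Finset.sum_le_sum hterm)
    _ = s.card * (2 / ((n : ℝ) + 1) ^ 2) := by rw [Finset.sum_const, nsmul_eq_mul]
    _ ≤ 2 * (n + 1) * (2 / ((n : ℝ) + 1) ^ 2) := by gcongr
    _ = 4 / (n + 1) := by field_simp; norm_num

theorem abs_sawBlock_le (n : ℕ) (x : ℝ) : |sawBlock n x| ≤ 4 / (n + 1) :=
  abs_sum_saw_div_le subset_rfl x

theorem integral_sum_saw_div_sq_le {s : Finset ℕ} (hs : ∀ l ∈ s, 0 < l) :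
    ∫ x in (0 : ℝ)..1, (∑ l ∈ s, saw (l * x) / l) ^ 2 ≤
      ∑ l ∈ s, ∑ m ∈ s, (Nat.gcd l m / (l * m) : ℝ) ^ 2 := by
  have hexpand : ∀ x : ℝ, (∑ l ∈ s, saw (l * x) / l) ^ 2 =
      ∑ p ∈ s ×ˢ s, saw (p.1 * x) * saw (p.2 * x) / (p.1 * p.2) := fun x => by
    simp only [sq, Finset.sum_mul_sum, Finset.sum_product, div_mul_div_comm]
  simp only [hexpand, ← Finset.sum_product']
  rw [intervalIntegral.integral_finsetSum fun p _ =>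
    (intervalIntegrable_saw_mul_saw p.1 p.2 0 1).div_const _]
  refine Finset.sum_le_sum fun p hp => ?_
  obtain ⟨hl, hm⟩ := Finset.mem_product.mp hp
  rw [intervalIntegral.integral_div, div_pow, sq ((p.1 : ℝ) * p.2),
    ← div_div _ ((p.1 : ℝ) * p.2)]
  gcongr
  exact (le_abs_self _).trans (abs_integral_saw_mul_saw_le (hs _ hl) (hs _ hm))

theorem gcd_le_of_mem_Ioc_sq {n l m : ℕ} (hl : l ∈ Finset.Ioc (n ^ 2) ((n + 1) ^ 2))
    (hm : m ∈ Finset.Ioc (n ^ 2) ((n + 1) ^ 2)) (hlm : l ≠ m) : Nat.gcd l m ≤ 2 * (n + 1) := by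
  wlog h : l < m generalizing l m
  · rw [Nat.gcd_comm]
    exact this hm hl hlm.symm (hlm.symm.lt_of_le (not_lt.mp h))
  have hdvd : Nat.gcd l m ∣ m - l := Nat.dvd_sub (Nat.gcd_dvd_right l m) (Nat.gcd_dvd_left l m)
  have hgcd := Nat.le_of_dvd (by omega) hdvd
  rw [Finset.mem_Ioc] at hl hm
  have hsq : (n + 1) ^ 2 = n ^ 2 + 2 * n + 1 := by ring
  omega

theorem gcd_div_mul_sq_le {n l m : ℕ} (hl : l ∈ Finset.Ioc (n ^ 2) ((n + 1) ^ 2))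
    (hm : m ∈ Finset.Ioc (n ^ 2) ((n + 1) ^ 2)) :
    (Nat.gcd l m / (l * m) : ℝ) ^ 2 ≤
      (if l = m then 4 / ((n : ℝ) + 1) ^ 4 else 0) + 64 / ((n : ℝ) + 1) ^ 6 := by
  have hl' : ((n : ℝ) + 1) ^ 2 / 2 ≤ l := by
    linarith [succ_sq_le_two_mul (Finset.mem_Ioc.mp hl).1]
  have hm' : ((n : ℝ) + 1) ^ 2 / 2 ≤ m := by
    linarith [succ_sq_le_two_mul (Finset.mem_Ioc.mp hm).1]
  split_ifs with h
  · subst h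
    have hl0 : (l : ℝ) ≠ 0 := (lt_of_lt_of_le (by positivity) hl').ne'
    calc (Nat.gcd l l / (l * l) : ℝ) ^ 2 = (1 / l) ^ 2 := by rw [Nat.gcd_self]; field_simp
      _ ≤ (1 / (((n : ℝ) + 1) ^ 2 / 2)) ^ 2 := by gcongr
      _ = 4 / ((n : ℝ) + 1) ^ 4 := by field_simp; norm_num
      _ ≤ _ := le_add_of_nonneg_right (by positivity)
  · have hgcd : (Nat.gcd l m : ℝ) ≤ 2 * (n + 1) := by exact_mod_cast gcd_le_of_mem_Ioc_sq hl hm h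
    calc (Nat.gcd l m / (l * m) : ℝ) ^ 2
        ≤ (2 * (n + 1) / (((n : ℝ) + 1) ^ 2 / 2 * (((n : ℝ) + 1) ^ 2 / 2))) ^ 2 := by gcongr
      _ = 0 + 64 / ((n : ℝ) + 1) ^ 6 := by field_simp; norm_num

theorem integral_sawBlock_sq_le (n : ℕ) :
    ∫ x in (0 : ℝ)..1, sawBlock n x ^ 2 ≤ 264 / ((n : ℝ) + 1) ^ 3 := by
  have hcard : ((Finset.Ioc (n ^ 2) ((n + 1) ^ 2)).card : ℝ) ≤ 2 * (n + 1) := by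
    rw [card_Ioc_sq]
    push_cast
    linarith
  calc ∫ x in (0 : ℝ)..1, sawBlock n x ^ 2
      ≤ ∑ l ∈ Finset.Ioc (n ^ 2) ((n + 1) ^ 2), ∑ m ∈ Finset.Ioc (n ^ 2) ((n + 1) ^ 2),
          ((if l = m then 4 / ((n : ℝ) + 1) ^ 4 else 0) + 64 / ((n : ℝ) + 1) ^ 6) :=
        (integral_sum_saw_div_sq_le fun l hl => (Finset.mem_Ioc.mp hl).1.pos).trans <|
          Finset.sum_le_sum fun l hl => Finset.sum_le_sum fun m hm => gcd_div_mul_sq_le hl hm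
    _ = (Finset.Ioc (n ^ 2) ((n + 1) ^ 2)).card * (4 / ((n : ℝ) + 1) ^ 4) +
          (Finset.Ioc (n ^ 2) ((n + 1) ^ 2)).card ^ 2 * (64 / ((n : ℝ) + 1) ^ 6) := by
        simp only [Finset.sum_add_distrib, Finset.sum_ite_eq, Finset.sum_const, nsmul_eq_mul]
        rw [Finset.sum_congr rfl fun l hl => if_pos hl, Finset.sum_const, nsmul_eq_mul]
        ring
    _ ≤ 2 * (n + 1) * (4 / ((n : ℝ) + 1) ^ 4) + (2 * (n + 1)) ^ 2 * (64 / ((n : ℝ) + 1) ^ 6) := by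
        gcongr
    _ = 8 / ((n : ℝ) + 1) ^ 3 + 256 / ((n : ℝ) + 1) ^ 4 := by field_simp; ring
    _ ≤ 8 / ((n : ℝ) + 1) ^ 3 + 256 / ((n : ℝ) + 1) ^ 3 := by
        gcongr
        · linarith [n.cast_nonneg (α := ℝ)]
        · norm_num
    _ = 264 / ((n : ℝ) + 1) ^ 3 := by ring

theorem memLp_sawBlock (n : ℕ) (p : ENNReal) : MemLp (sawBlock n) p unitMeasure :=
  MemLp.of_bound (measurable_sawBlock n).aestronglyMeasurable (4 / (n + 1))
    (Eventually.of_forall fun x => by simpa using abs_sawBlock_le n x)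

theorem integral_norm_sawBlock_pow_le (j n : ℕ) :
    ∫ x, ‖sawBlock n x‖ ^ (j + 2) ∂unitMeasure ≤ 4 ^ j * 264 / ((n : ℝ) + 1) ^ (j + 3) := by
  have hint : ∀ i ≠ 0, Integrable (fun x => ‖sawBlock n x‖ ^ i) unitMeasure := fun i hi =>
    (memLp_sawBlock n i).integrable_norm_pow hi
  have hsq := integral_sawBlock_sq_le n
  rw [intervalIntegral.integral_of_le zero_le_one] at hsq
  calc ∫ x, ‖sawBlock n x‖ ^ (j + 2) ∂unitMeasure
      ≤ ∫ x, (4 / ((n : ℝ) + 1)) ^ j * ‖sawBlock n x‖ ^ 2 ∂unitMeasure := by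
        refine integral_mono (hint _ (by simp)) ((hint 2 two_ne_zero).const_mul _) fun x => ?_
        simp only [pow_add]
        gcongr
        exact abs_sawBlock_le n x
    _ = (4 / ((n : ℝ) + 1)) ^ j * ∫ x, sawBlock n x ^ 2 ∂unitMeasure := by
        rw [integral_const_mul]
        simp only [Real.norm_eq_abs, sq_abs]
    _ ≤ (4 / ((n : ℝ) + 1)) ^ j * (264 / ((n : ℝ) + 1) ^ 3) := by gcongr
    _ = 4 ^ j * 264 / ((n : ℝ) + 1) ^ (j + 3) := by rw [div_pow, div_mul_div_comm, ← pow_add]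

theorem eLpNorm_sawBlock_le (j n : ℕ) :
    eLpNorm (sawBlock n) ((j + 2 : ℕ) : ENNReal) unitMeasure ≤
      ENNReal.ofReal ((4 ^ j * 264 : ℝ) ^ ((j + 2 : ℕ) : ℝ)⁻¹ *
        ((n + 1 : ℕ) : ℝ) ^ (-(1 + ((j + 2 : ℕ) : ℝ)⁻¹))) := by
  rw [(memLp_sawBlock n _).eLpNorm_eq_integral_rpow_norm (by simp) (ENNReal.natCast_ne_top _)]
  refine ENNReal.ofReal_le_ofReal ?_
  simp only [ENNReal.toReal_natCast, Real.rpow_natCast]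
  calc (∫ x, ‖sawBlock n x‖ ^ (j + 2) ∂unitMeasure) ^ ((j + 2 : ℕ) : ℝ)⁻¹
      ≤ (4 ^ j * 264 / ((n : ℝ) + 1) ^ (j + 3)) ^ ((j + 2 : ℕ) : ℝ)⁻¹ :=
        Real.rpow_le_rpow (integral_nonneg fun x => by positivity)
          (integral_norm_sawBlock_pow_le j n) (by positivity)
    _ = _ := by
        rw [Real.div_rpow (by positivity) (by positivity), div_eq_mul_inv, ← Nat.cast_succ,
          ← Real.rpow_natCast _ (j + 3), ← Real.rpow_mul (by positivity),
          ← Real.rpow_neg (by positivity)]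
        congr 3
        push_cast
        field_simp
        ring

theorem tsum_eLpNorm_sawBlock_ne_top {p : ENNReal} (hp : p ≠ ⊤) :
    ∑' n, eLpNorm (sawBlock n) p unitMeasure ≠ ⊤ := by
  obtain ⟨j, hj⟩ := ENNReal.exists_nat_gt hp
  have hmono : ∀ n, eLpNorm (sawBlock n) p unitMeasure ≤
      eLpNorm (sawBlock n) ((j + 2 : ℕ) : ENNReal) unitMeasure := fun n =>
    eLpNorm_le_eLpNorm_of_exponent_le (hj.le.trans (by exact_mod_cast j.le_add_right 2))
      (measurable_sawBlock n).aestronglyMeasurable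
  have hsum : Summable fun n : ℕ => (n : ℝ) ^ (-(1 + ((j + 2 : ℕ) : ℝ)⁻¹)) := by
    rw [Real.summable_nat_rpow, neg_lt_neg_iff]
    exact lt_add_of_pos_right _ (by positivity)
  exact ne_top_of_le_ne_top
    (((summable_nat_add_iff 1).mpr hsum).mul_left ((4 ^ j * 264 : ℝ) ^ _)).tsum_ofReal_ne_top
    (ENNReal.tsum_le_tsum fun n => (hmono n).trans (eLpNorm_sawBlock_le j n))

theorem ae_summable_sawBlock : ∀ᵐ x ∂unitMeasure, Summable fun n => sawBlock n x := by
  filter_upwards [summable_norm_of_tsum_eLpNorm_ne_top le_rfl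
    (fun n => (measurable_sawBlock n).aestronglyMeasurable)
    (tsum_eLpNorm_sawBlock_ne_top ENNReal.one_ne_top)] with x hx using hx.of_norm

theorem sum_sawBlock (n : ℕ) (x : ℝ) :
    ∑ i ∈ Finset.range n, sawBlock i x = ∑ l ∈ Finset.Ioc 0 (n ^ 2), saw (l * x) / l := by
  induction n with
  | zero => simp
  | succ n ih =>
    rw [Finset.sum_range_succ, ih, sawBlock,
      Finset.sum_Ioc_consecutive _ (Nat.zero_le _) (by gcongr; exact n.le_succ)]

theorem tendsto_sum_saw_div {x : ℝ} (hx : Summable fun n => sawBlock n x) :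
    Tendsto (fun N : ℕ => ∑ l ∈ Finset.Ioc 0 N, saw (l * x) / l) atTop
      (𝓝 (∑' n, sawBlock n x)) := by
  have hsqrt : Tendsto Nat.sqrt atTop atTop :=
    tendsto_atTop_atTop.mpr fun n => ⟨n ^ 2, fun a ha => by rwa [Nat.le_sqrt, ← sq]⟩
  have hblocks := hx.hasSum.tendsto_sum_nat.comp hsqrt
  have htail : Tendsto (fun N : ℕ => ∑ l ∈ Finset.Ioc (N.sqrt ^ 2) N, saw (l * x) / l) atTop
      (𝓝 0) := by
    refine squeeze_zero_norm (a := fun N : ℕ => 4 / ((N.sqrt + 1 : ℕ) : ℝ)) (fun N => ?_) ?_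
    · rw [Nat.cast_succ]
      exact abs_sum_saw_div_le (Finset.Ioc_subset_Ioc_right (Nat.lt_succ_sqrt' N).le) x
    · exact (tendsto_const_div_atTop_nhds_zero_nat 4).comp ((tendsto_add_atTop_nat 1).comp hsqrt)
  have hlim := hblocks.add htail
  rw [add_zero] at hlim
  refine hlim.congr fun N => ?_
  rw [Function.comp_apply, sum_sawBlock,
    Finset.sum_Ioc_consecutive _ (Nat.zero_le _) (Nat.sqrt_le' N)]

theorem g_ae_eq_tsum_sawBlock : g =ᵐ[unitMeasure] fun x => ∑' n, sawBlock n x := by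
  filter_upwards [ae_summable_sawBlock] with x hx
  exact (tendsto_sum_saw_div hx).limUnder_eq

theorem memLp_tsum {α E : Type*} [MeasurableSpace α] {μ : Measure α} [NormedAddCommGroup E]
    [CompleteSpace E] {p : ENNReal} [Fact (1 ≤ p)] {f : ℕ → α → E} (hf : ∀ n, MemLp (f n) p μ)
    (hsum : ∑' n, eLpNorm (f n) p μ ≠ ⊤) : MemLp (fun x => ∑' n, f n x) p μ := by
  have hcoe : ⇑(∑' n, (hf n).toLp (f n)) =ᵐ[μ] fun x => ∑' n, (hf n).toLp (f n) x :=
    Lp.coeFn_tsum (by simpa only [Lp.enorm_toLp] using hsum)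
  refine (Lp.memLp (∑' n, (hf n).toLp (f n))).ae_eq (hcoe.trans ?_)
  filter_upwards [ae_all_iff.mpr fun n => (hf n).coeFn_toLp] with x hx
  exact tsum_congr hx

theorem memLp_g {p : ENNReal} (hp : p ≠ ⊤) : MemLp g p unitMeasure := by
  have : Fact (1 ≤ max 1 p) := ⟨le_max_left 1 p⟩
  have hmem : MemLp g (max 1 p) unitMeasure :=
    (memLp_congr_ae g_ae_eq_tsum_sawBlock).mpr <| memLp_tsum (fun n => memLp_sawBlock n _)
      (tsum_eLpNorm_sawBlock_ne_top (max_lt ENNReal.one_lt_top hp.lt_top).ne)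
  exact hmem.mono_exponent (le_max_right 1 p)

theorem integrable_g_pow (n : ℕ) : Integrable (fun x => g x ^ n) unitMeasure :=
  have hg := memLp_g (ENNReal.natCast_ne_top n)
  hg.integrable_norm_pow'.mono' (hg.aestronglyMeasurable.pow n)
    (Eventually.of_forall fun x => (norm_pow (g x) n).le)

theorem intervalIntegrable_saw (a b : ℝ) : IntervalIntegrable saw volume a b :=
  intervalIntegrable_of_measurable_of_abs_le measurable_saw abs_saw_le_one a b

theorem integral_saw_of_mem_Icc {t : ℝ} (ht : t ∈ Set.Icc (0 : ℝ) 1) :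
    ∫ x in (0 : ℝ)..t, saw x = t * (1 - t) := by
  calc ∫ x in (0 : ℝ)..t, saw x = ∫ x in (0 : ℝ)..t, (1 - 2 * x) := by
        rw [intervalIntegral.integral_of_le ht.1, intervalIntegral.integral_of_le ht.1,
          integral_Ioc_eq_integral_Ioo, integral_Ioc_eq_integral_Ioo]
        exact setIntegral_congr_fun measurableSet_Ioo fun x hx =>
          saw_of_mem_Ico ⟨hx.1.le, hx.2.trans_le ht.2⟩
    _ = t * (1 - t) := by
        rw [intervalIntegral.integral_sub (by simp)
            (Continuous.intervalIntegrable (by fun_prop) _ _),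
          intervalIntegral.integral_const, intervalIntegral.integral_const_mul, integral_id,
          smul_eq_mul]
        ring

theorem integral_saw (y : ℝ) : ∫ x in (0 : ℝ)..y, saw x = Int.fract y * (1 - Int.fract y) := by
  have hperiods := saw_periodic.intervalIntegral_add_zsmul_eq ⌊y⌋ 0 intervalIntegrable_saw
  rw [zero_add, zero_add, zsmul_one,
    integral_saw_of_mem_Icc (Set.right_mem_Icc.mpr zero_le_one), sub_self, mul_zero,
    smul_zero] at hperiods
  have hrest : ∫ x in (⌊y⌋ : ℝ)..y, saw x = ∫ x in (0 : ℝ)..Int.fract y, saw x := by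
    have hshift := intervalIntegral.integral_comp_add_right (a := 0) (b := Int.fract y) saw ⌊y⌋
    rw [zero_add, Int.fract_add_floor] at hshift
    rw [← hshift]
    simp only [saw, Int.fract_add_intCast]
  rw [← intervalIntegral.integral_add_adjacent_intervals (intervalIntegrable_saw 0 ⌊y⌋)
    (intervalIntegrable_saw ⌊y⌋ y), hperiods, zero_add, hrest,
    integral_saw_of_mem_Icc ⟨Int.fract_nonneg y, (Int.fract_lt_one y).le⟩]

theorem integral_saw_nonneg (y : ℝ) : 0 ≤ ∫ x in (0 : ℝ)..y, saw x := by
  rw [integral_saw]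
  exact mul_nonneg (Int.fract_nonneg y) (sub_nonneg.mpr (Int.fract_lt_one y).le)

theorem integral_saw_mul {l : ℝ} (hl : l ≠ 0) (δ : ℝ) :
    ∫ x in (0 : ℝ)..δ, saw (l * x) = (∫ x in (0 : ℝ)..l * δ, saw x) / l := by
  rw [intervalIntegral.integral_comp_mul_left _ hl, mul_zero, smul_eq_mul, inv_mul_eq_div]

theorem integral_saw_mul_nonneg {l : ℕ} (hl : 0 < l) (δ : ℝ) :
    0 ≤ ∫ x in (0 : ℝ)..δ, saw (l * x) := by
  rw [integral_saw_mul (Nat.cast_ne_zero.mpr hl.ne')]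
  exact div_nonneg (integral_saw_nonneg _) l.cast_nonneg

theorem integral_sum_saw_mul_div (s : Finset ℕ) (δ : ℝ) :
    ∫ x in (0 : ℝ)..δ, ∑ l ∈ s, saw (l * x) / l =
      ∑ l ∈ s, (∫ x in (0 : ℝ)..δ, saw (l * x)) / l := by
  rw [intervalIntegral.integral_finsetSum]
  · simp only [intervalIntegral.integral_div]
  · exact fun l _ => (intervalIntegrable_of_measurable_of_abs_le (measurable_saw_mul l)
      (fun x => abs_saw_le_one _) 0 δ).div_const _

theorem integral_sawBlock_nonneg (n : ℕ) (δ : ℝ) : 0 ≤ ∫ x in (0 : ℝ)..δ, sawBlock n x := by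
  unfold sawBlock
  rw [integral_sum_saw_mul_div]
  exact Finset.sum_nonneg fun l hl =>
    div_nonneg (integral_saw_mul_nonneg (Finset.mem_Ioc.mp hl).1.pos δ) l.cast_nonneg

theorem hasSum_setIntegral_sawBlock {s : Set ℝ} (hs : s ⊆ Set.Ioc 0 1) :
    HasSum (fun n => ∫ x in s, sawBlock n x) (∫ x in s, g x) := by
  have hle : volume.restrict s ≤ unitMeasure := Measure.restrict_mono hs le_rfl
  have hint : ∀ n, Integrable (sawBlock n) (volume.restrict s) := fun n =>
    (memLp_one_iff_integrable.mp (memLp_sawBlock n 1)).mono_measure hle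
  rw [integral_congr_ae (ae_mono hle g_ae_eq_tsum_sawBlock)]
  refine hasSum_integral_of_summable_integral_norm hint ?_
  simp only [integral_norm_eq_lintegral_enorm (measurable_sawBlock _).aestronglyMeasurable,
    ← eLpNorm_one_eq_lintegral_enorm]
  exact ENNReal.summable_toReal <| ne_top_of_le_ne_top
    (tsum_eLpNorm_sawBlock_ne_top ENNReal.one_ne_top)
    (ENNReal.tsum_le_tsum fun n => eLpNorm_mono_measure _ hle)

theorem sum_integral_saw_mul_div_le_integral_g {δ : ℝ} (hδ0 : 0 ≤ δ) (hδ1 : δ ≤ 1) (N : ℕ) :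
    ∑ l ∈ Finset.Ioc 0 N, (∫ x in (0 : ℝ)..δ, saw (l * x)) / l ≤ ∫ x in (0 : ℝ)..δ, g x := by
  have hsum := hasSum_setIntegral_sawBlock (Set.Ioc_subset_Ioc_right hδ1 : Set.Ioc 0 δ ⊆ _)
  simp only [← intervalIntegral.integral_of_le hδ0] at hsum
  calc ∑ l ∈ Finset.Ioc 0 N, (∫ x in (0 : ℝ)..δ, saw (l * x)) / l
      ≤ ∑ l ∈ Finset.Ioc 0 (N ^ 2), (∫ x in (0 : ℝ)..δ, saw (l * x)) / l :=
        Finset.sum_le_sum_of_subset_of_nonneg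
          (Finset.Ioc_subset_Ioc_right (Nat.le_self_pow two_ne_zero N)) fun l hl _ =>
            div_nonneg (integral_saw_mul_nonneg (Finset.mem_Ioc.mp hl).1 δ) l.cast_nonneg
    _ = ∑ n ∈ Finset.range N, ∫ x in (0 : ℝ)..δ, sawBlock n x := by
        rw [← integral_sum_saw_mul_div, ← intervalIntegral.integral_finsetSum]
        · simp only [sum_sawBlock]
        · exact fun n _ => intervalIntegrable_of_measurable_of_abs_le (measurable_sawBlock n)
            (abs_sawBlock_le n) 0 δ
    _ ≤ ∫ x in (0 : ℝ)..δ, g x :=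
        sum_le_hasSum _ (fun n _ => integral_sawBlock_nonneg n δ) hsum

theorem log_le_sum_inv (M : ℕ) : Real.log M ≤ ∑ l ∈ Finset.Ioc 0 M, (l : ℝ)⁻¹ := by
  have h := log_le_harmonic_floor M M.cast_nonneg
  rw [Nat.floor_natCast, harmonic_eq_sum_Icc] at h
  push_cast at h
  exact h

theorem le_integral_g {M : ℕ} (hM : 1 ≤ M) :
    (Real.log M - 1) / M ≤ ∫ x in (0 : ℝ)..1 / M, g x := by
  have hM' : (0 : ℝ) < M := by exact_mod_cast hM
  have hterm : ∀ l ∈ Finset.Ioc 0 M,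
      (∫ x in (0 : ℝ)..1 / M, saw (l * x)) / l = (l : ℝ)⁻¹ / M - 1 / M ^ 2 := by
    intro l hl
    obtain ⟨hl0, hlM⟩ := Finset.mem_Ioc.mp hl
    have hl0' : (l : ℝ) ≠ 0 := Nat.cast_ne_zero.mpr hl0.ne'
    have hmem : (l : ℝ) * (1 / M) ∈ Set.Icc (0 : ℝ) 1 := by
      refine ⟨by positivity, ?_⟩
      rw [mul_one_div, div_le_one hM']
      exact_mod_cast hlM
    rw [integral_saw_mul hl0', integral_saw_of_mem_Icc hmem]
    field_simp
  calc (Real.log M - 1) / M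
      ≤ (∑ l ∈ Finset.Ioc 0 M, (l : ℝ)⁻¹ - 1) / M := by gcongr; exact log_le_sum_inv M
    _ = ∑ l ∈ Finset.Ioc 0 M, (∫ x in (0 : ℝ)..1 / M, saw (l * x)) / l := by
        rw [Finset.sum_congr rfl hterm, Finset.sum_sub_distrib, ← Finset.sum_div,
          Finset.sum_const, Nat.card_Ioc, Nat.sub_zero, nsmul_eq_mul]
        field_simp
    _ ≤ ∫ x in (0 : ℝ)..1 / M, g x := sum_integral_saw_mul_div_le_integral_g (by positivity)
        ((div_le_one hM').mpr (by exact_mod_cast hM)) M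

theorem integralMoment_eq (k : ℕ) :
    integralMoment k = (∫ x, g x ^ (2 * k) ∂unitMeasure) / Real.pi ^ (2 * k) := by
  rw [integralMoment, intervalIntegral.integral_of_le zero_le_one, ← integral_div]
  simp only [div_pow]

theorem hasLogLowerBound_integralMoment : HasLogLowerBound integralMoment := by
  intro k M hlog
  have hM : 1 ≤ M := pos_of_log_natCast_pos (by linarith)
  have hM' : (1 : ℝ) ≤ M := by exact_mod_cast hM
  have hδ0 : (0 : ℝ) ≤ 1 / M := by positivity
  have hle : volume.restrict (Set.Ioc 0 (1 / M : ℝ)) ≤ unitMeasure :=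
    Measure.restrict_mono
      (Set.Ioc_subset_Ioc_right ((div_le_one (by positivity)).mpr hM')) le_rfl
  have hmass : (volume.restrict (Set.Ioc 0 (1 / M : ℝ))).real Set.univ = 1 / M := by
    rw [measureReal_restrict_apply_univ, Real.volume_real_Ioc_of_le hδ0, sub_zero]
  have hmean : 1 / M * (Real.log M - 3) ≤ ∫ x in Set.Ioc 0 (1 / M : ℝ), g x := by
    rw [← intervalIntegral.integral_of_le hδ0, one_div_mul_eq_div]
    refine le_trans ?_ (le_integral_g hM)
    gcongr
    norm_num
  have hjensen := measureReal_mul_pow_le_integral_pow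
    ((memLp_one_iff_integrable.mp (memLp_g ENNReal.one_ne_top)).mono_measure hle)
    ((integrable_g_pow (2 * k)).mono_measure hle) (c := Real.log M - 3) (by linarith)
    (by rwa [hmass]) (even_two_mul k)
  rw [hmass] at hjensen
  rw [integralMoment_eq, div_pow, div_right_comm]
  gcongr
  calc (Real.log M - 3) ^ (2 * k) / (4 * M)
      ≤ (Real.log M - 3) ^ (2 * k) / M :=
        div_le_div_of_nonneg_left ((even_two_mul k).pow_nonneg _) (by positivity) (by linarith)
    _ = 1 / M * (Real.log M - 3) ^ (2 * k) := by ring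
    _ ≤ ∫ x in Set.Ioc 0 (1 / M : ℝ), g x ^ (2 * k) := hjensen
    _ ≤ ∫ x, g x ^ (2 * k) ∂unitMeasure :=
        integral_mono_measure hle
          (Eventually.of_forall fun x => (even_two_mul k).pow_nonneg _) (integrable_g_pow _)

/-! ### Fourier analysis modulo `b` -/

/-- The bound `2 / |e(v / b) - 1|` for the sums of `e(v t / b)` over intervals. -/
noncomputable def geomWeight (b : ℕ) [NeZero b] (v : ZMod b) : ℝ :=
  2 / ‖ZMod.stdAddChar v - 1‖

theorem geomWeight_nonneg (b : ℕ) [NeZero b] (v : ZMod b) : 0 ≤ geomWeight b v := by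
  unfold geomWeight
  positivity

theorem geomWeight_zero (b : ℕ) [NeZero b] : geomWeight b 0 = 0 := by simp [geomWeight]

theorem norm_stdAddChar {b : ℕ} [NeZero b] (v : ZMod b) : ‖ZMod.stdAddChar v‖ = 1 :=
  Circle.norm_coe (ZMod.toCircle v)

theorem norm_sum_Ico_stdAddChar_le {b : ℕ} [NeZero b] {v : ZMod b} (hv : v ≠ 0) (α β : ℕ) :
    ‖∑ t ∈ Finset.Ico α β, ZMod.stdAddChar (v * (t : ZMod b))‖ ≤ geomWeight b v := by
  have hpow : ∀ t : ℕ, ZMod.stdAddChar (v * (t : ZMod b)) = ZMod.stdAddChar v ^ t := fun t => by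
    rw [mul_comm, ← nsmul_eq_mul, AddChar.map_nsmul_eq_pow]
  have hne : ZMod.stdAddChar v ≠ 1 := fun h => hv (ZMod.injective_stdAddChar (by simpa using h))
  simp only [hpow]
  rcases le_or_gt α β with h | h
  · rw [geom_sum_Ico hne h, norm_div, geomWeight]
    gcongr
    refine (norm_sub_le _ _).trans_eq ?_
    rw [norm_pow, norm_pow, norm_stdAddChar, one_pow, one_pow, one_add_one_eq_two]
  · rw [Finset.Ico_eq_empty h.not_gt, Finset.sum_empty, norm_zero]
    exact geomWeight_nonneg b v

theorem two_mul_mul_one_sub_le_sin {x : ℝ} (hx0 : 0 ≤ x) (hx1 : x ≤ 1) :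
    2 * (x * (1 - x)) ≤ Real.sin (Real.pi * x) := by
  wlog hx : x ≤ 1 / 2 generalizing x
  · have h := this (sub_nonneg.mpr hx1) (sub_le_self 1 hx0) (by linarith)
    rw [show Real.pi * (1 - x) = Real.pi - Real.pi * x by ring, Real.sin_pi_sub] at h
    linarith
  have hsin := Real.mul_le_sin (x := Real.pi * x) (by positivity) (by nlinarith [Real.pi_pos])
  rw [← mul_assoc, div_mul_cancel₀ _ Real.pi_ne_zero] at hsin
  nlinarith

theorem norm_stdAddChar_natCast_sub_one {b : ℕ} [NeZero b] {j : ℕ} (hj : j ≤ b) :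
    ‖ZMod.stdAddChar (j : ZMod b) - 1‖ = 2 * Real.sin (Real.pi * (j / b)) := by
  have hb : (0 : ℝ) < b := by exact_mod_cast NeZero.pos b
  have hj' : (j : ℝ) / b ≤ 1 := (div_le_one hb).mpr (by exact_mod_cast hj)
  have hchar : (ZMod.stdAddChar (j : ZMod b) : ℂ) =
      Complex.exp (Complex.I * ((2 * (Real.pi * (j / b)) : ℝ) : ℂ)) := by
    have h := ZMod.stdAddChar_coe (N := b) (j : ℤ)
    rw [Int.cast_natCast] at h
    rw [h]
    congr 1
    push_cast
    ring
  rw [hchar, Complex.norm_exp_I_mul_ofReal_sub_one, mul_div_cancel_left₀ _ two_ne_zero,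
    norm_mul, Real.norm_two, Real.norm_of_nonneg]
  exact Real.sin_nonneg_of_nonneg_of_le_pi (by positivity)
    (mul_le_of_le_one_right Real.pi_pos.le hj')

theorem geomWeight_natCast_le {b : ℕ} [NeZero b] {j : ℕ} (hj0 : 0 < j) (hjb : j < b) :
    geomWeight b (j : ZMod b) ≤ (b : ℝ) / 2 * (1 / j + 1 / ((b - j : ℕ) : ℝ)) := by
  have hj0' : (0 : ℝ) < j := by exact_mod_cast hj0
  have hjb' : (j : ℝ) < b := by exact_mod_cast hjb
  have hb : (0 : ℝ) < b := hj0'.trans hjb'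
  have hbj : (0 : ℝ) < b - j := sub_pos.mpr hjb'
  have hx1 : (j : ℝ) / b < 1 := (div_lt_one hb).mpr hjb'
  calc geomWeight b (j : ZMod b) = 2 / (2 * Real.sin (Real.pi * (j / b))) := by
        rw [geomWeight, norm_stdAddChar_natCast_sub_one hjb.le]
    _ ≤ 2 / (2 * (2 * (j / b * (1 - j / b)))) := by
        have : 0 < (j : ℝ) / b * (1 - j / b) := mul_pos (by positivity) (sub_pos.mpr hx1)
        gcongr
        exact two_mul_mul_one_sub_le_sin (by positivity) hx1.le
    _ = (b : ℝ) / 2 * (1 / j + 1 / ((b - j : ℕ) : ℝ)) := by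
        rw [Nat.cast_sub hjb.le]
        field_simp
        ring

theorem sum_inv_Ico_le (b : ℕ) : ∑ j ∈ Finset.Ico 1 b, (1 : ℝ) / j ≤ 1 + Real.log b := by
  have h := harmonic_le_one_add_log b
  rw [harmonic_eq_sum_Icc] at h
  push_cast at h
  simp only [one_div]
  exact (Finset.sum_le_sum_of_subset_of_nonneg Finset.Ico_subset_Icc_self
    fun _ _ _ => by positivity).trans h

theorem sum_geomWeight_le (b : ℕ) [NeZero b] :
    ∑ v, geomWeight b v ≤ b * (1 + Real.log b) := by
  have hreflect : ∑ j ∈ Finset.Ico 1 b, (1 : ℝ) / ((b - j : ℕ) : ℝ) =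
      ∑ j ∈ Finset.Ico 1 b, (1 : ℝ) / j := by
    simpa using Finset.sum_Ico_reflect (fun j => (1 : ℝ) / (j : ℝ)) 1 b.le_succ
  rw [← sum_range_natCast_zmod b (geomWeight b), Finset.range_eq_Ico,
    Finset.sum_eq_sum_Ico_succ_bot (NeZero.pos b), Nat.cast_zero, geomWeight_zero, zero_add,
    zero_add]
  calc ∑ j ∈ Finset.Ico 1 b, geomWeight b (j : ZMod b)
      ≤ ∑ j ∈ Finset.Ico 1 b, (b : ℝ) / 2 * (1 / j + 1 / ((b - j : ℕ) : ℝ)) :=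
        Finset.sum_le_sum fun j hj =>
          geomWeight_natCast_le (Finset.mem_Ico.mp hj).1 (Finset.mem_Ico.mp hj).2
    _ = b * ∑ j ∈ Finset.Ico 1 b, (1 : ℝ) / j := by
        rw [← Finset.mul_sum, Finset.sum_add_distrib, hreflect]
        ring
    _ ≤ b * (1 + Real.log b) := by
        gcongr
        exact sum_inv_Ico_le b

/-- `f` has Wiener norm (sum of the absolute values of the Fourier coefficients) at most `C`. This
is expressed by duality, so that no coefficients have to be named: every linear functional bounded
by `B` on all additive characters is bounded by `C * B` at `f`. -/
def WienerBound (b : ℕ) [NeZero b] (f : ZMod b → ℂ) (C : ℝ) : Prop :=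
  ∀ (T : (ZMod b → ℂ) →ₗ[ℂ] ℂ) (B : ℝ), (∀ u, ‖T fun s => ZMod.stdAddChar (u * s)‖ ≤ B) →
    ‖T f‖ ≤ C * B

namespace WienerBound

variable {b : ℕ} [NeZero b] {f g : ZMod b → ℂ} {C D : ℝ}

theorem stdAddChar_mul (u : ZMod b) : WienerBound b (fun s => ZMod.stdAddChar (u * s)) 1 :=
  fun T B hT => by simpa using hT u

theorem mono (hf : WienerBound b f C) (h : C ≤ D) : WienerBound b f D := fun T B hT =>
  (hf T B hT).trans (mul_le_mul_of_nonneg_right h ((norm_nonneg _).trans (hT 0)))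

theorem add (hf : WienerBound b f C) (hg : WienerBound b g D) : WienerBound b (f + g) (C + D) :=
  fun T B hT => by
    rw [map_add, add_mul]
    exact (norm_add_le _ _).trans (add_le_add (hf T B hT) (hg T B hT))

theorem smul (hf : WienerBound b f C) (a : ℂ) : WienerBound b (a • f) (‖a‖ * C) :=
  fun T B hT => by
    rw [map_smul, norm_smul, mul_assoc]
    exact mul_le_mul_of_nonneg_left (hf T B hT) (norm_nonneg _)

theorem sum {ι : Type*} (s : Finset ι) {F : ι → ZMod b → ℂ} {C : ι → ℝ}
    (h : ∀ i ∈ s, WienerBound b (F i) (C i)) :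
    WienerBound b (∑ i ∈ s, F i) (∑ i ∈ s, C i) := fun T B hT => by
  rw [map_sum, Finset.sum_mul]
  exact norm_sum_le_of_le _ fun i hi => h i hi T B hT

theorem mul (hf : WienerBound b f C) (hg : WienerBound b g D) :
    WienerBound b (f * g) (C * D) := fun T B hT => by
  have hchar : ∀ u, ‖T ((fun s => ZMod.stdAddChar (u * s)) * g)‖ ≤ D * B := fun u => by
    refine hg (T ∘ₗ LinearMap.mulLeft ℂ fun s => ZMod.stdAddChar (u * s)) B fun v => ?_
    have hmul : (fun s => ZMod.stdAddChar (u * s)) * (fun s => ZMod.stdAddChar (v * s)) =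
        fun s => (ZMod.stdAddChar ((u + v) * s) : ℂ) := by
      ext s
      rw [Pi.mul_apply, add_mul, AddChar.map_add_eq_mul]
    rw [LinearMap.comp_apply, LinearMap.mulLeft_apply, hmul]
    exact hT (u + v)
  rw [mul_assoc]
  exact hf (T ∘ₗ LinearMap.mulRight ℂ g) (D * B) hchar

theorem comp_mul (hf : WienerBound b f C) (m : ZMod b) :
    WienerBound b (fun s => f (m * s)) C := fun T B hT =>
  hf (T ∘ₗ LinearMap.funLeft ℂ ℂ fun s => m * s) B fun u => by
    have h := hT (u * m)
    simp only [mul_assoc] at h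
    exact h

end WienerBound

/-- The indicator function of the residues represented by `0, …, K - 1`. -/
noncomputable def initialIndicator (b K : ℕ) (s : ZMod b) : ℂ := if s.val < K then 1 else 0

theorem ite_eq_inv_mul_sum_stdAddChar {b : ℕ} [NeZero b] (s t : ZMod b) :
    (if s = t then 1 else 0 : ℂ) = (b : ℂ)⁻¹ * ∑ u : ZMod b, ZMod.stdAddChar (u * (s - t)) := by
  have horth := AddChar.sum_mulShift (s - t) (ZMod.isPrimitive_stdAddChar b)
  simp only [horth, ZMod.card, sub_eq_zero, Nat.cast_ite, Nat.cast_zero, mul_ite, mul_zero,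
    inv_mul_cancel₀ (NeZero.ne (b : ℂ))]

theorem initialIndicator_eq_sum {b : ℕ} [NeZero b] {K : ℕ} (hK : K ≤ b) :
    initialIndicator b K = ∑ u : ZMod b,
      ((b : ℂ)⁻¹ * ∑ n ∈ Finset.range K, ZMod.stdAddChar (-u * (n : ZMod b))) •
        fun s : ZMod b => (ZMod.stdAddChar (u * s) : ℂ) := by
  ext s
  calc initialIndicator b K s
      = ∑ n ∈ Finset.range K, if s.val = n then (1 : ℂ) else 0 := by
        simp [initialIndicator]
    _ = ∑ n ∈ Finset.range K, if s = (n : ZMod b) then (1 : ℂ) else 0 := by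
        refine Finset.sum_congr rfl fun n hn => if_congr ?_ rfl rfl
        rw [← (ZMod.val_injective b).eq_iff,
          ZMod.val_natCast_of_lt ((Finset.mem_range.mp hn).trans_le hK)]
    _ = ∑ u : ZMod b, ((b : ℂ)⁻¹ * ∑ n ∈ Finset.range K, ZMod.stdAddChar (-u * (n : ZMod b))) *
          ZMod.stdAddChar (u * s) := by
        simp only [ite_eq_inv_mul_sum_stdAddChar, mul_assoc, Finset.sum_mul,
          ← Finset.mul_sum, ← AddChar.map_add_eq_mul]
        rw [Finset.sum_comm]
        congr! 4
        ring
    _ = _ := by simp only [Finset.sum_apply, Pi.smul_apply, smul_eq_mul]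

theorem norm_sum_range_stdAddChar_le {b : ℕ} [NeZero b] {K : ℕ} (hK : K ≤ b) (v : ZMod b) :
    ‖∑ n ∈ Finset.range K, (ZMod.stdAddChar (v * (n : ZMod b)) : ℂ)‖ ≤
      (if v = 0 then (b : ℝ) else 0) + geomWeight b v := by
  split_ifs with hv
  · subst hv
    simpa [geomWeight_zero] using hK
  · rw [zero_add, Finset.range_eq_Ico]
    exact norm_sum_Ico_stdAddChar_le hv 0 K

theorem wienerBound_initialIndicator {b : ℕ} [NeZero b] {K : ℕ} (hK : K ≤ b) :
    WienerBound b (initialIndicator b K) (2 + Real.log b) := by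
  have hb : (0 : ℝ) < b := by exact_mod_cast NeZero.pos b
  rw [initialIndicator_eq_sum hK]
  refine (WienerBound.sum _ fun u _ => (WienerBound.stdAddChar_mul u).smul _).mono ?_
  simp only [mul_one, norm_mul, norm_inv, Complex.norm_natCast, ← Finset.mul_sum]
  rw [inv_mul_le_iff₀ hb]
  calc ∑ u : ZMod b, ‖∑ n ∈ Finset.range K, (ZMod.stdAddChar (-u * (n : ZMod b)) : ℂ)‖
      ≤ ∑ u : ZMod b, ((if -u = 0 then (b : ℝ) else 0) + geomWeight b (-u)) :=
        Finset.sum_le_sum fun u _ => norm_sum_range_stdAddChar_le hK (-u)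
    _ = b + ∑ u : ZMod b, geomWeight b u := by
        simpa [Finset.sum_add_distrib] using Equiv.sum_comp (Equiv.neg (ZMod b)) (geomWeight b)
    _ ≤ b + b * (1 + Real.log b) := by
        gcongr
        exact sum_geomWeight_le b
    _ = b * (2 + Real.log b) := by ring

/-- The function `s ↦ saw (s / b)` on residues modulo `b`. -/
noncomputable def sawMod (b : ℕ) (s : ZMod b) : ℝ := saw (s.val / b)

theorem sawMod_eq {b : ℕ} [NeZero b] (s : ZMod b) : sawMod b s = 1 - 2 * (s.val / b) := by
  have hb : (0 : ℝ) < b := by exact_mod_cast NeZero.pos b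
  exact saw_of_mem_Ico ⟨by positivity, (div_lt_one hb).mpr (by exact_mod_cast s.val_lt)⟩

theorem sawMod_natCast (b : ℕ) [NeZero b] (n : ℕ) : sawMod b n = saw (n / b) :=
  periodic_apply_val_div saw_periodic b n

theorem sawMod_neg {b : ℕ} [NeZero b] {z : ZMod b} (hz : z ≠ 0) :
    sawMod b (-z) = -sawMod b z := by
  have hb : (b : ℝ) ≠ 0 := NeZero.ne _
  rw [sawMod_eq, sawMod_eq, ZMod.neg_val, if_neg hz, Nat.cast_sub z.val_lt.le]
  field_simp
  ring

theorem sum_initialIndicator_succ {b : ℕ} [NeZero b] (s : ZMod b) :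
    ∑ i ∈ Finset.range b, initialIndicator b (i + 1) s = (b : ℂ) - s.val := by
  have hfilter : (Finset.range b).filter (fun i => s.val < i + 1) = Finset.Ico s.val b := by
    ext i
    simp [and_comm]
  simp only [initialIndicator]
  rw [Finset.sum_boole, hfilter, Nat.card_Ico, Nat.cast_sub s.val_lt.le]

theorem wienerBound_sawMod (b : ℕ) [NeZero b] :
    WienerBound b (fun s => (sawMod b s : ℂ)) (5 + 2 * Real.log b) := by
  have hb : (b : ℂ) ≠ 0 := NeZero.ne _
  have hb' : (b : ℝ) ≠ 0 := NeZero.ne _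
  have hsaw : (fun s => (sawMod b s : ℂ)) =
      (-1 : ℂ) • (fun s => (ZMod.stdAddChar (0 * s) : ℂ)) +
        (2 / (b : ℂ)) • ∑ i ∈ Finset.range b, initialIndicator b (i + 1) := by
    ext s
    simp only [Pi.add_apply, Pi.smul_apply, Finset.sum_apply, smul_eq_mul,
      sum_initialIndicator_succ, sawMod_eq, zero_mul, AddChar.map_zero_eq_one]
    push_cast
    field_simp
    ring
  rw [hsaw]
  refine (((WienerBound.stdAddChar_mul 0).smul _).add ((WienerBound.sum _ fun i hi =>
    wienerBound_initialIndicator (K := i + 1) (Finset.mem_range.mp hi)).smul _)).mono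
    (le_of_eq ?_)
  rw [Finset.sum_const, Finset.card_range, nsmul_eq_mul, norm_div, Complex.norm_natCast,
    norm_neg, norm_one, Complex.norm_two]
  field_simp
  ring

/-! ### Inverses modulo `q²` -/

/-- The indicator function of `A₀ b ≤ r ≤ A₁ b`, minus its density `A₁ - A₀`. -/
noncomputable def balancedWeight (A₀ A₁ : ℝ) (b r : ℕ) : ℝ :=
  (if A₀ * b ≤ r ∧ (r : ℝ) ≤ A₁ * b then 1 else 0) - (A₁ - A₀)

/-- Reduction modulo `q` of a residue modulo `q²`. -/
noncomputable abbrev reduce (q : ℕ) : ZMod (q ^ 2) →+* ZMod q :=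
  ZMod.castHom (dvd_pow_self q two_ne_zero) (ZMod q)

theorem stdAddChar_natCast_mul_eq_reduce (q : ℕ) [NeZero q] (v : ZMod (q ^ 2)) :
    (ZMod.stdAddChar ((q : ZMod (q ^ 2)) * v) : ℂ) = ZMod.stdAddChar (reduce q v) := by
  have hq : (q : ℂ) ≠ 0 := NeZero.ne _
  obtain ⟨n, rfl⟩ := ZMod.intCast_surjective v
  rw [← Int.cast_natCast (R := ZMod (q ^ 2)), ← Int.cast_mul, map_intCast (reduce q),
    ZMod.stdAddChar_coe, ZMod.stdAddChar_coe]
  congr 1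
  push_cast
  field_simp

theorem inv_add_mul_sq {q r t : ℕ} (hr : r.Coprime (q ^ 2)) :
    ((r + q * t : ℕ) : ZMod (q ^ 2))⁻¹ =
      (r : ZMod (q ^ 2))⁻¹ - q * (t * ((r : ZMod (q ^ 2))⁻¹) ^ 2) := by
  have hunit : (r : ZMod (q ^ 2)) * (r : ZMod (q ^ 2))⁻¹ = 1 := ZMod.coe_mul_inv_eq_one r hr
  have hq : (q : ZMod (q ^ 2)) ^ 2 = 0 := by exact_mod_cast ZMod.natCast_self (q ^ 2)
  set i := (r : ZMod (q ^ 2))⁻¹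
  apply ZMod.inv_eq_of_mul_eq_one
  push_cast
  linear_combination (1 - (q : ZMod (q ^ 2)) * t * i) * hunit - (t : ZMod (q ^ 2)) ^ 2 * i ^ 2 * hq

theorem reduce_inv {q r : ℕ} (hr : r.Coprime (q ^ 2)) :
    reduce q ((r : ZMod (q ^ 2))⁻¹) = (r : ZMod q)⁻¹ := by
  have hunit := congrArg (reduce q) (ZMod.coe_mul_inv_eq_one r hr)
  rw [map_mul, map_natCast, map_one] at hunit
  exact (ZMod.inv_eq_of_mul_eq_one _ _ _ hunit).symm

-- Along `r + q ℕ` inversion modulo `q²` is affine, so the phases form a geometric progression.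
theorem stdAddChar_mul_inv_add_mul {q r : ℕ} [NeZero q] (u : ZMod (q ^ 2))
    (hr : r.Coprime (q ^ 2)) (t : ℕ) :
    (ZMod.stdAddChar (u * ((r + q * t : ℕ) : ZMod (q ^ 2))⁻¹) : ℂ) =
      ZMod.stdAddChar (u * (r : ZMod (q ^ 2))⁻¹) *
        ZMod.stdAddChar (-reduce q u * ((r : ZMod q)⁻¹) ^ 2 * (t : ZMod q)) := by
  have hsplit : u * ((r + q * t : ℕ) : ZMod (q ^ 2))⁻¹ = u * (r : ZMod (q ^ 2))⁻¹ +
      q * (-u * ((r : ZMod (q ^ 2))⁻¹) ^ 2 * t) := by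
    rw [inv_add_mul_sq hr]
    ring
  rw [hsplit, AddChar.map_add_eq_mul, stdAddChar_natCast_mul_eq_reduce, map_mul (reduce q),
    map_mul (reduce q), map_pow, map_neg, map_natCast, reduce_inv hr]

theorem norm_sum_Ico_sub_mul_sum_range_le {b : ℕ} [NeZero b] (v : ZMod b) {α β : ℕ} {c : ℝ}
    (hcard : |((Finset.Ico α β).card : ℝ) - c * b| ≤ 1) :
    ‖∑ t ∈ Finset.Ico α β, (ZMod.stdAddChar (v * (t : ZMod b)) : ℂ) -
        c * ∑ t ∈ Finset.range b, (ZMod.stdAddChar (v * (t : ZMod b)) : ℂ)‖ ≤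
      1 + geomWeight b v := by
  rcases eq_or_ne v 0 with rfl | hv
  · rw [← Real.norm_eq_abs, ← Complex.norm_real] at hcard
    simpa [geomWeight_zero] using hcard
  · have hfull : ∑ t ∈ Finset.range b, (ZMod.stdAddChar (v * (t : ZMod b)) : ℂ) = 0 := by
      simp_rw [mul_comm v]
      rw [sum_range_natCast_zmod b fun t => (ZMod.stdAddChar (t * v) : ℂ),
        AddChar.sum_mulShift v (ZMod.isPrimitive_stdAddChar b), if_neg hv, Nat.cast_zero]
    rw [hfull, mul_zero, sub_zero]
    exact (norm_sum_Ico_stdAddChar_le hv α β).trans (le_add_of_nonneg_left zero_le_one)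

theorem mul_sub_div_le_iff {q : ℝ} (hq : 0 < q) (A r t : ℝ) :
    A * q - r / q ≤ t ↔ A * q ^ 2 ≤ r + q * t := by
  rw [sub_le_iff_le_add, ← mul_le_mul_iff_right₀ hq]
  field_simp
  rw [add_comm]

theorem le_mul_sub_div_iff {q : ℝ} (hq : 0 < q) (A r t : ℝ) :
    t ≤ A * q - r / q ↔ r + q * t ≤ A * q ^ 2 := by
  rw [le_sub_iff_add_le, ← mul_le_mul_iff_right₀ hq]
  field_simp
  rw [add_comm]

theorem filter_interval_eq_Ico (A₀ : ℝ) {A₁ : ℝ} (h1 : A₁ ≤ 1) {q r : ℕ} (hq : 0 < q)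
    (hr : 0 < r) :
    (Finset.range q).filter (fun t => A₀ * (q ^ 2 : ℕ) ≤ ((r + q * t : ℕ) : ℝ) ∧
      ((r + q * t : ℕ) : ℝ) ≤ A₁ * (q ^ 2 : ℕ)) =
    Finset.Ico ⌈A₀ * q - r / q⌉₊ ⌊A₁ * q - r / q + 1⌋₊ := by
  have hq' : (0 : ℝ) < q := by exact_mod_cast hq
  have hr' : (0 : ℝ) < r := by exact_mod_cast hr
  ext t
  rw [Finset.mem_filter, Finset.mem_range, Finset.mem_Ico, Nat.ceil_le, ← Nat.succ_le_iff (m := t),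
    ← Nat.succ_le_iff (m := t), Nat.le_floor_iff' (Nat.succ_ne_zero t), Nat.succ_eq_add_one]
  push_cast
  rw [add_le_add_iff_right, mul_sub_div_le_iff hq', le_mul_sub_div_iff hq']
  refine ⟨fun h => h.2, fun h => ⟨?_, h⟩⟩
  have hlt : (q : ℝ) * t < q * q := by nlinarith [h.2, mul_pos hq' hq']
  exact_mod_cast lt_of_mul_lt_mul_left hlt hq'.le

theorem abs_card_Ico_ceil_floor_sub_le {x y : ℝ} (hx : -1 ≤ x) (hxy : x ≤ y) :
    |((Finset.Ico ⌈x⌉₊ ⌊y + 1⌋₊).card : ℝ) - (y - x)| ≤ 1 := by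
  have hceil : x ≤ ⌈x⌉₊ := Nat.le_ceil x
  have hceil' : (⌈x⌉₊ : ℝ) ≤ x + 1 := by
    rcases le_or_gt 0 x with h | h
    · exact (Nat.ceil_lt_add_one h).le
    · rw [Nat.ceil_eq_zero.mpr h.le, Nat.cast_zero]
      linarith
  have hfloor : y < ⌊y + 1⌋₊ := by linarith [Nat.lt_floor_add_one (y + 1)]
  have hfloor' : (⌊y + 1⌋₊ : ℝ) ≤ y + 1 := Nat.floor_le (by linarith)
  rw [Nat.card_Ico, abs_le]
  rcases le_or_gt ⌈x⌉₊ ⌊y + 1⌋₊ with h | h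
  · rw [Nat.cast_sub h]
    constructor <;> linarith
  · have h' : (⌊y + 1⌋₊ : ℝ) < ⌈x⌉₊ := by exact_mod_cast h
    rw [Nat.sub_eq_zero_of_le h.le, Nat.cast_zero]
    constructor <;> linarith

theorem norm_sum_balancedWeight_add_mul_le {A₀ A₁ : ℝ} (h0 : 0 ≤ A₀) (h01 : A₀ ≤ A₁) (h1 : A₁ ≤ 1)
    {q r : ℕ} [NeZero q] (u : ZMod (q ^ 2)) (hr0 : 0 < r) (hr : r < q)
    (hcop : r.Coprime (q ^ 2)) :
    ‖∑ t ∈ Finset.range q, (balancedWeight A₀ A₁ (q ^ 2) (r + q * t) : ℂ) *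
        ZMod.stdAddChar (u * ((r + q * t : ℕ) : ZMod (q ^ 2))⁻¹)‖ ≤
      1 + geomWeight q (-reduce q u * ((r : ZMod q)⁻¹) ^ 2) := by
  have hq : (0 : ℝ) < q := by exact_mod_cast hr0.trans hr
  have hrq : (r : ℝ) / q ≤ 1 := (div_le_one hq).mpr (by exact_mod_cast hr.le)
  set v : ZMod q := -reduce q u * ((r : ZMod q)⁻¹) ^ 2
  set J := Finset.Ico ⌈A₀ * q - r / q⌉₊ ⌊A₁ * q - r / q + 1⌋₊ with hJ
  have hcard : |(J.card : ℝ) - (A₁ - A₀) * q| ≤ 1 := by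
    convert abs_card_Ico_ceil_floor_sub_le (x := A₀ * q - r / q) (y := A₁ * q - r / q) ?_ ?_
      using 3
    · ring
    · nlinarith
    · gcongr
  have hsum : ∑ t ∈ Finset.range q, (balancedWeight A₀ A₁ (q ^ 2) (r + q * t) : ℂ) *
        ZMod.stdAddChar (u * ((r + q * t : ℕ) : ZMod (q ^ 2))⁻¹) =
      ZMod.stdAddChar (u * (r : ZMod (q ^ 2))⁻¹) *
        (∑ t ∈ J, ZMod.stdAddChar (v * (t : ZMod q)) -
          ((A₁ - A₀ : ℝ) : ℂ) * ∑ t ∈ Finset.range q, ZMod.stdAddChar (v * (t : ZMod q))) := by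
    rw [hJ, ← filter_interval_eq_Ico A₀ h1 (hr0.trans hr) hr0, Finset.sum_filter, Finset.mul_sum,
      ← Finset.sum_sub_distrib, Finset.mul_sum]
    refine Finset.sum_congr rfl fun t _ => ?_
    rw [stdAddChar_mul_inv_add_mul u hcop, balancedWeight]
    split_ifs <;> push_cast <;> ring
  rw [hsum, norm_mul, norm_stdAddChar, one_mul]
  exact norm_sum_Ico_sub_mul_sum_range_le v hcard

theorem card_filter_mul_inv_sq_eq_le_two {F : Type*} [Field F] [Fintype F] [DecidableEq F] {c : F}
    (hc : c ≠ 0) (v : F) : (Finset.univ.filter fun x : F => c * x⁻¹ ^ 2 = v).card ≤ 2 := by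
  rcases (Finset.univ.filter fun x : F => c * x⁻¹ ^ 2 = v).eq_empty_or_nonempty with h | ⟨y, hy⟩
  · rw [h, Finset.card_empty]
    exact zero_le_two
  · refine (Finset.card_le_card (t := {y, -y}) fun x hx => ?_).trans Finset.card_le_two
    rw [Finset.mem_filter] at hx hy
    have hsq : x⁻¹ ^ 2 = y⁻¹ ^ 2 := mul_left_cancel₀ hc (hx.2.trans hy.2.symm)
    rw [Finset.mem_insert, Finset.mem_singleton]
    refine (sq_eq_sq_iff_eq_or_eq_neg.mp hsq).imp inv_inj.mp fun h => ?_
    rwa [← inv_neg, inv_inj] at h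

theorem sum_comp_mul_inv_sq_le {F : Type*} [Field F] [Fintype F] {c : F} (hc : c ≠ 0)
    {w : F → ℝ} (hw : ∀ v, 0 ≤ w v) : ∑ x, w (c * x⁻¹ ^ 2) ≤ 2 * ∑ v, w v := by
  classical
  rw [Finset.sum_comp w fun x => c * x⁻¹ ^ 2, Finset.mul_sum]
  refine (Finset.sum_le_sum fun v _ => ?_).trans (Finset.sum_le_sum_of_subset_of_nonneg
    (Finset.subset_univ _) fun v _ _ => mul_nonneg zero_le_two (hw v))
  rw [nsmul_eq_mul]
  exact mul_le_mul_of_nonneg_right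
    (by exact_mod_cast card_filter_mul_inv_sq_eq_le_two hc v) (hw v)

theorem sum_geomWeight_mul_inv_sq_le {q : ℕ} [Fact q.Prime] (c : ZMod q) :
    ∑ x, geomWeight q (c * x⁻¹ ^ 2) ≤ 2 * (q * (1 + Real.log q)) := by
  rcases eq_or_ne c 0 with rfl | hc
  · have : 0 ≤ Real.log q := Real.log_natCast_nonneg q
    simp only [zero_mul, geomWeight_zero, Finset.sum_const_zero]
    positivity
  · refine (sum_comp_mul_inv_sq_le hc (geomWeight_nonneg q)).trans ?_
    gcongr
    exact sum_geomWeight_le q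

theorem sum_range_sq {E : Type*} [AddCommMonoid E] (q : ℕ) (F : ℕ → E) :
    ∑ r ∈ Finset.range (q ^ 2), F r =
      ∑ r ∈ Finset.range q, ∑ t ∈ Finset.range q, F (r + q * t) := by
  rcases q.eq_zero_or_pos with rfl | hq
  · simp
  rw [← Finset.sum_product']
  refine Finset.sum_bij' (fun r _ => (r % q, r / q)) (fun p _ => p.1 + q * p.2)
    (fun r hr => ?_) (fun p hp => ?_) (fun r _ => Nat.mod_add_div r q) (fun p hp => ?_)
    fun r _ => by rw [Nat.mod_add_div]
  · simp only [Finset.mem_product, Finset.mem_range] at hr ⊢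
    exact ⟨Nat.mod_lt _ hq, Nat.div_lt_of_lt_mul (by rwa [← sq])⟩
  · simp only [Finset.mem_product, Finset.mem_range] at hp ⊢
    nlinarith
  · simp only [Finset.mem_product, Finset.mem_range] at hp
    simp [Nat.mod_eq_of_lt hp.1, Nat.add_mul_div_left _ _ hq, Nat.div_eq_of_lt hp.1]

theorem coprime_add_mul_sq_iff {q r : ℕ} (hq : q.Prime) (hr : r < q) (t : ℕ) :
    (r + q * t).Coprime (q ^ 2) ↔ r ≠ 0 := by
  rw [Nat.coprime_pow_right_iff two_pos, Nat.coprime_comm, hq.coprime_iff_not_dvd,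
    ← Nat.dvd_add_iff_left (Dvd.intro t rfl), Nat.dvd_iff_mod_eq_zero, Nat.mod_eq_of_lt hr]

/-- The natural numbers below `b` that are coprime to `b`. -/
def coprimeRange (b : ℕ) : Finset ℕ := (Finset.range b).filter fun r => r.Coprime b

theorem norm_sum_balancedWeight_le {A₀ A₁ : ℝ} (h0 : 0 ≤ A₀) (h01 : A₀ ≤ A₁) (h1 : A₁ ≤ 1)
    {q : ℕ} [Fact q.Prime] (u : ZMod (q ^ 2)) :
    ‖∑ r ∈ coprimeRange (q ^ 2), (balancedWeight A₀ A₁ (q ^ 2) r : ℂ) *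
        ZMod.stdAddChar (u * (r : ZMod (q ^ 2))⁻¹)‖ ≤ 3 * q * (1 + Real.log q) := by
  have hp : q.Prime := Fact.out
  have hlog : 0 ≤ q * Real.log q := mul_nonneg q.cast_nonneg (Real.log_natCast_nonneg q)
  set c := -reduce q u
  have hrow : ∀ r ∈ Finset.range q, ‖∑ t ∈ Finset.range q,
      (if (r + q * t).Coprime (q ^ 2) then (balancedWeight A₀ A₁ (q ^ 2) (r + q * t) : ℂ) *
        ZMod.stdAddChar (u * ((r + q * t : ℕ) : ZMod (q ^ 2))⁻¹) else 0)‖ ≤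
      1 + geomWeight q (c * ((r : ZMod q)⁻¹) ^ 2) := fun r hr => by
    rw [Finset.mem_range] at hr
    simp only [coprime_add_mul_sq_iff hp hr, Finset.sum_ite_irrel, Finset.sum_const_zero]
    split_ifs with h
    · exact norm_sum_balancedWeight_add_mul_le h0 h01 h1 u (Nat.pos_of_ne_zero h) hr
        (by simpa using (coprime_add_mul_sq_iff hp hr 0).mpr h)
    · rw [norm_zero]
      exact add_nonneg zero_le_one (geomWeight_nonneg q _)
  rw [coprimeRange, Finset.sum_filter, sum_range_sq]
  refine (norm_sum_le_of_le _ hrow).trans ?_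
  rw [Finset.sum_add_distrib, Finset.sum_const, Finset.card_range, nsmul_eq_mul, mul_one,
    sum_range_natCast_zmod q fun x => geomWeight q (c * x⁻¹ ^ 2)]
  linarith [sum_geomWeight_mul_inv_sq_le c]

/-! ### Cotangent sums -/

theorem cot_pi_mul_periodic : Function.Periodic (fun x => Real.cot (Real.pi * x)) 1 := fun x => by
  simp only [mul_add, mul_one, Real.cot_eq_cos_div_sin, Real.cos_add_pi, Real.sin_add_pi,
    neg_div_neg_eq]

/-- The function `z ↦ cot (π z / b)` on residues modulo `b`. -/
noncomputable def cotMod (b : ℕ) (z : ZMod b) : ℝ := Real.cot (Real.pi * (z.val / b))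

theorem cotMod_natCast (b : ℕ) [NeZero b] (n : ℕ) :
    cotMod b n = Real.cot (Real.pi * (n / b)) :=
  periodic_apply_val_div cot_pi_mul_periodic b n

theorem cotMod_zero (b : ℕ) : cotMod b 0 = 0 := by
  simp [cotMod, Real.cot_eq_cos_div_sin]

theorem cotMod_neg {b : ℕ} [NeZero b] (z : ZMod b) : cotMod b (-z) = -cotMod b z := by
  have hb : (b : ℝ) ≠ 0 := NeZero.ne _
  rcases eq_or_ne z 0 with rfl | hz
  · rw [neg_zero, cotMod_zero, neg_zero]
  · rw [cotMod, cotMod, ZMod.neg_val, if_neg hz, Nat.cast_sub z.val_lt.le, sub_div, div_self hb,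
      mul_sub, mul_one, Real.cot_eq_cos_div_sin, Real.cot_eq_cos_div_sin, Real.cos_pi_sub,
      Real.sin_pi_sub, neg_div]

theorem sum_cotMod (b : ℕ) [NeZero b] : ∑ z, cotMod b z = 0 := by
  have h := Equiv.sum_comp (Equiv.neg (ZMod b)) (cotMod b)
  simp only [Equiv.neg_apply, cotMod_neg, Finset.sum_neg_distrib] at h
  linarith

theorem cotSum_eq_neg_sum_zmod (r b : ℕ) [NeZero b] :
    cotSum r b = -∑ z : ZMod b, ((z.val : ℝ) / b) * cotMod b (z * r) := by
  rw [cotSum, ← sum_range_natCast_zmod b fun z : ZMod b => ((z.val : ℝ) / b) * cotMod b (z * r),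
    Finset.range_eq_Ico, Finset.sum_eq_sum_Ico_succ_bot (NeZero.pos b), Nat.cast_zero,
    ZMod.val_zero, Nat.cast_zero, zero_div, zero_mul, zero_add, zero_add]
  congr 1
  refine Finset.sum_congr rfl fun m hm => ?_
  rw [ZMod.val_natCast_of_lt (Finset.mem_Ico.mp hm).2, ← Nat.cast_mul, cotMod_natCast,
    Nat.cast_mul, mul_assoc Real.pi, mul_div_assoc]

theorem cotSum_eq_sum_zmod {r b : ℕ} [NeZero b] (hr : r.Coprime b) :
    cotSum r b = (∑ z : ZMod b, sawMod b (z * (r : ZMod b)⁻¹) * cotMod b z) / 2 := by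
  have hunit : (r : ZMod b) * (r : ZMod b)⁻¹ = 1 := ZMod.coe_mul_inv_eq_one r hr
  have hsubst : ∑ z : ZMod b, ((z.val : ℝ) / b) * cotMod b (z * r) =
      ∑ z : ZMod b, (((z * (r : ZMod b)⁻¹).val : ℝ) / b) * cotMod b z := by
    rw [← Equiv.sum_comp (Units.mulRight (ZMod.unitOfCoprime r hr)) fun z : ZMod b =>
      (((z * (r : ZMod b)⁻¹).val : ℝ) / b) * cotMod b z]
    simp only [Units.mulRight_apply, ZMod.coe_unitOfCoprime, mul_assoc, hunit, mul_one]
  rw [cotSum_eq_neg_sum_zmod, hsubst]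
  simp only [sawMod_eq, sub_mul, one_mul, Finset.sum_sub_distrib, sum_cotMod, mul_assoc (2 : ℝ),
    ← Finset.mul_sum]
  ring

theorem sum_zmod_eq_two_mul_sum_Ico {b : ℕ} [NeZero b] {f : ZMod b → ℝ}
    (heven : ∀ z, f (-z) = f z) (hfix : ∀ z, -z = z → f z = 0) :
    ∑ z, f z = 2 * ∑ m ∈ Finset.Ico 1 ((b + 1) / 2), f m := by
  have hb : 0 < b := NeZero.pos b
  have hreflect : ∑ m ∈ Finset.Ico ((b + 1) / 2) b, f m =
      ∑ m ∈ Finset.Ico 1 (b + 1 - (b + 1) / 2), f m := by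
    have h := Finset.sum_Ico_reflect (fun m : ℕ => f m) ((b + 1) / 2) b.le_succ
    rw [Nat.add_sub_cancel_left] at h
    rw [← h]
    refine Finset.sum_congr rfl fun m hm => ?_
    rw [Nat.cast_sub (Finset.mem_Ico.mp hm).2.le, ZMod.natCast_self, zero_sub, heven]
  have hmiddle : ∑ m ∈ Finset.Ico 1 (b + 1 - (b + 1) / 2), f m =
      ∑ m ∈ Finset.Ico 1 ((b + 1) / 2), f m := by
    refine (Finset.sum_subset (Finset.Ico_subset_Ico_right (by omega)) fun (m : ℕ) hm hm' =>
      hfix m ?_).symm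
    rw [Finset.mem_Ico] at hm hm'
    have hmb : m + m = b := by omega
    rw [neg_eq_iff_add_eq_zero, ← Nat.cast_add, hmb, ZMod.natCast_self]
  rw [← sum_range_natCast_zmod b f, Finset.range_eq_Ico, Finset.sum_eq_sum_Ico_succ_bot hb,
    Nat.cast_zero, hfix 0 neg_zero, zero_add, zero_add, two_mul]
  rcases (Nat.one_le_iff_ne_zero.mpr hb.ne').eq_or_lt with rfl | hb1
  · simp
  · rw [← Finset.sum_Ico_consecutive _ (by omega : 1 ≤ (b + 1) / 2) (by omega), hreflect, hmiddle]

theorem cotSum_eq_sum_half {r b : ℕ} [NeZero b] (hr : r.Coprime b) :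
    cotSum r b = ∑ m ∈ Finset.Ico 1 ((b + 1) / 2),
      sawMod b ((m : ZMod b) * (r : ZMod b)⁻¹) * cotMod b m := by
  have hinv : ∀ z : ZMod b, z * (r : ZMod b)⁻¹ = 0 → z = 0 := fun z hz => by
    have hunit : (r : ZMod b)⁻¹ * r = 1 := (mul_comm _ _).trans (ZMod.coe_mul_inv_eq_one r hr)
    rw [← mul_one z, ← hunit, ← mul_assoc, hz, zero_mul]
  rw [cotSum_eq_sum_zmod hr, sum_zmod_eq_two_mul_sum_Ico (f := fun z : ZMod b =>
    sawMod b (z * (r : ZMod b)⁻¹) * cotMod b z) (fun z => ?_) (fun z hz => ?_),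
    mul_div_cancel_left₀ _ two_ne_zero]
  · rcases eq_or_ne z 0 with rfl | hz
    · rw [neg_zero]
    · rw [neg_mul, sawMod_neg fun h => hz (hinv z h), cotMod_neg, neg_mul_neg]
  · have hcot : cotMod b z = 0 := by linarith [cotMod_neg z, congrArg (cotMod b) hz]
    rw [hcot, mul_zero]

theorem fract_mul_one_sub_fract_add_le {θ : ℝ} (h0 : 0 ≤ θ) (h1 : θ < 1) (y : ℝ) :
    Int.fract (y + θ) * (1 - Int.fract (y + θ)) - 2 * θ * ⌊y + θ⌋ + θ ^ 2 ≤
      Int.fract y * (1 - Int.fract y) - 2 * θ * ⌊y⌋ + θ * saw y := by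
  have : 0 ≤ Int.fract y := Int.fract_nonneg y
  have hfract1 : Int.fract y < 1 := Int.fract_lt_one y
  have hdecomp : y + θ = ⌊y⌋ + (Int.fract y + θ) := by rw [← add_assoc, Int.floor_add_fract]
  rw [hdecomp, Int.fract_intCast_add, Int.floor_intCast_add, saw]
  rcases lt_or_ge (Int.fract y + θ) 1 with h | h
  · rw [Int.fract_eq_self.mpr ⟨by positivity, h⟩, Int.floor_eq_zero_iff.mpr ⟨by positivity, h⟩]
    push_cast
    nlinarith
  · have hfloor : ⌊Int.fract y + θ⌋ = 1 := by
      rw [Int.floor_eq_iff]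
      push_cast
      constructor <;> linarith
    rw [← Int.self_sub_floor (Int.fract y + θ), hfloor]
    push_cast
    nlinarith

theorem le_mul_sum_saw {θ : ℝ} (h0 : 0 ≤ θ) (h1 : θ < 1) (K : ℕ) :
    Int.fract (K * θ) * (1 - Int.fract (K * θ)) - 2 * θ * ⌊K * θ⌋ + K * θ ^ 2 ≤
      θ * ∑ s ∈ Finset.range K, saw (s * θ) := by
  induction K with
  | zero => simp
  | succ K ih =>
    have hstep := fract_mul_one_sub_fract_add_le h0 h1 (K * θ)
    rw [Finset.sum_range_succ, Nat.cast_succ, add_one_mul]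
    linarith

theorem neg_mul_le_sum_saw {θ : ℝ} (h0 : 0 < θ) (h1 : θ < 1) (K : ℕ) :
    -(K * θ) ≤ ∑ s ∈ Finset.range K, saw (s * θ) := by
  have hfract : 0 ≤ Int.fract (K * θ) * (1 - Int.fract (K * θ)) :=
    mul_nonneg (Int.fract_nonneg _) (sub_nonneg.mpr (Int.fract_lt_one _).le)
  have hfloor : θ * ⌊K * θ⌋ ≤ θ * (K * θ) := mul_le_mul_of_nonneg_left (Int.floor_le _) h0.le
  refine le_of_mul_le_mul_left ?_ h0
  linarith [le_mul_sum_saw h0.le h1 K]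

theorem mul_one_sub_mul_le_sum_saw {θ : ℝ} (h0 : 0 < θ) (h1 : θ < 1) {K : ℕ} (hK : K * θ < 1) :
    K * (1 - K * θ) ≤ ∑ s ∈ Finset.range K, saw (s * θ) := by
  have hmem : (K : ℝ) * θ ∈ Set.Ico (0 : ℝ) 1 := ⟨by positivity, hK⟩
  have hle := le_mul_sum_saw h0.le h1 K
  rw [Int.fract_eq_self.mpr hmem, Int.floor_eq_zero_iff.mpr hmem, Int.cast_zero] at hle
  refine le_of_mul_le_mul_left ?_ h0
  have hsq : 0 ≤ (K : ℝ) * θ ^ 2 := by positivity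
  linarith

theorem mul_cot_le_one {x : ℝ} (h0 : 0 < x) (h1 : x < Real.pi / 2) : x * Real.cot x ≤ 1 := by
  have hcos : 0 < Real.cos x := Real.cos_pos_of_mem_Ioo ⟨by linarith, h1⟩
  have hsin : 0 < Real.sin x := Real.sin_pos_of_pos_of_lt_pi h0 (by linarith)
  have htan := Real.lt_tan h0 h1
  rw [Real.tan_eq_sin_div_cos, lt_div_iff₀ hcos] at htan
  rw [Real.cot_eq_cos_div_sin, ← mul_div_assoc, div_le_one hsin]
  exact htan.le

theorem cot_nonneg {x : ℝ} (h0 : 0 ≤ x) (h1 : x ≤ Real.pi / 2) : 0 ≤ Real.cot x := by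
  rw [Real.cot_eq_cos_div_sin]
  exact div_nonneg (Real.cos_nonneg_of_mem_Icc ⟨by linarith, h1⟩)
    (Real.sin_nonneg_of_nonneg_of_le_pi h0 (by linarith))

theorem one_sub_sq_div_two_le_mul_cot {x : ℝ} (h0 : 0 < x) (h1 : x ≤ Real.pi / 2) :
    1 - x ^ 2 / 2 ≤ x * Real.cot x := by
  have hcos : 0 ≤ Real.cos x := Real.cos_nonneg_of_mem_Icc ⟨by linarith, h1⟩
  have hsin : 0 < Real.sin x := Real.sin_pos_of_pos_of_lt_pi h0 (by linarith)
  refine Real.one_sub_sq_div_two_le_cos.trans ?_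
  rw [Real.cot_eq_cos_div_sin, ← mul_div_assoc, le_div_iff₀ hsin, mul_comm x]
  exact mul_le_mul_of_nonneg_left (Real.sin_lt h0).le hcos

/-- The weight `(π / b) cot (π m / b)`, close to `1 / m` for small `m`. -/
noncomputable def cotWeight (b m : ℕ) : ℝ := Real.pi / b * cotMod b m

section cotWeight

variable {b m : ℕ}

theorem cotWeight_eq (hm : 0 < m) (hmb : 2 * m < b) :
    cotWeight b m = Real.pi * (m / b) * Real.cot (Real.pi * (m / b)) / m := by
  have : NeZero b := ⟨by omega⟩
  have hm' : (m : ℝ) ≠ 0 := by exact_mod_cast hm.ne'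
  rw [cotWeight, cotMod_natCast]
  field_simp

theorem pi_mul_div_mem_Ioo (hm : 0 < m) (hmb : 2 * m < b) :
    Real.pi * (m / b) ∈ Set.Ioo 0 (Real.pi / 2) := by
  have hm' : (0 : ℝ) < m := by exact_mod_cast hm
  have hmb' : 2 * (m : ℝ) < b := by exact_mod_cast hmb
  have hhalf : (m : ℝ) / b < 1 / 2 := by
    rw [div_lt_div_iff₀ (by linarith) two_pos]
    linarith
  have hpos : 0 < (m : ℝ) / b := div_pos hm' (by linarith)
  constructor <;> nlinarith [Real.pi_pos]

theorem cotWeight_nonneg (hm : 0 < m) (hmb : 2 * m < b) : 0 ≤ cotWeight b m := by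
  obtain ⟨hx0, hx1⟩ := pi_mul_div_mem_Ioo hm hmb
  rw [cotWeight_eq hm hmb]
  exact div_nonneg (mul_nonneg hx0.le (cot_nonneg hx0.le hx1.le)) m.cast_nonneg

theorem cotWeight_le (hm : 0 < m) (hmb : 2 * m < b) : cotWeight b m ≤ 1 / m := by
  obtain ⟨hx0, hx1⟩ := pi_mul_div_mem_Ioo hm hmb
  rw [cotWeight_eq hm hmb]
  exact div_le_div_of_nonneg_right (mul_cot_le_one hx0 hx1) m.cast_nonneg

theorem le_cotWeight (hm : 0 < m) (hmb : 2 * m < b) :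
    1 / (m : ℝ) - 5 * m / (b : ℝ) ^ 2 ≤ cotWeight b m := by
  obtain ⟨hx0, hx1⟩ := pi_mul_div_mem_Ioo hm hmb
  have hm' : (m : ℝ) ≠ 0 := by exact_mod_cast hm.ne'
  have hpi : Real.pi ^ 2 / 2 ≤ 5 := by nlinarith [Real.pi_lt_d2, Real.pi_pos]
  calc 1 / (m : ℝ) - 5 * m / (b : ℝ) ^ 2 ≤ 1 / m - Real.pi ^ 2 / 2 * m / (b : ℝ) ^ 2 := by gcongr
    _ = (1 - (Real.pi * (m / b)) ^ 2 / 2) / m := by field_simp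
    _ ≤ Real.pi * (m / b) * Real.cot (Real.pi * (m / b)) / m := by
        gcongr
        exact one_sub_sq_div_two_le_mul_cot hx0 hx1.le
    _ = cotWeight b m := (cotWeight_eq hm hmb).symm

end cotWeight

theorem sum_cotWeight_le (b : ℕ) :
    ∑ m ∈ Finset.Ico 1 ((b + 1) / 2), |cotWeight b m| ≤ 1 + Real.log b :=
  calc ∑ m ∈ Finset.Ico 1 ((b + 1) / 2), |cotWeight b m|
      ≤ ∑ m ∈ Finset.Ico 1 ((b + 1) / 2), (1 : ℝ) / m := by
        refine Finset.sum_le_sum fun m hm => ?_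
        rw [Finset.mem_Ico] at hm
        rw [abs_of_nonneg (cotWeight_nonneg hm.1 (by omega))]
        exact cotWeight_le hm.1 (by omega)
    _ ≤ ∑ m ∈ Finset.Ico 1 b, (1 : ℝ) / m :=
        Finset.sum_le_sum_of_subset_of_nonneg (Finset.Ico_subset_Ico_right (by omega))
          fun _ _ _ => by positivity
    _ ≤ 1 + Real.log b := sum_inv_Ico_le b

/-- The cotangent sum `c₀(r/b)`, normalized to `(π / b) c₀(r/b)`, as a function of `s = r⁻¹`. -/
noncomputable def invCotSum (b : ℕ) (s : ZMod b) : ℝ :=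
  ∑ m ∈ Finset.Ico 1 ((b + 1) / 2), cotWeight b m * sawMod b (m * s)

theorem cotSum_eq_invCotSum {r b : ℕ} [NeZero b] (hr : r.Coprime b) :
    cotSum r b = b / Real.pi * invCotSum b (r : ZMod b)⁻¹ := by
  have hb : (b : ℝ) ≠ 0 := NeZero.ne _
  rw [cotSum_eq_sum_half hr, invCotSum, Finset.mul_sum]
  refine Finset.sum_congr rfl fun m _ => ?_
  rw [cotWeight]
  field_simp

theorem invCotSum_le {b : ℕ} (s : ZMod b) : invCotSum b s ≤ 1 + Real.log b := by
  refine (Finset.sum_le_sum fun m _ => (le_abs_self _).trans ?_).trans (sum_cotWeight_le b)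
  rw [abs_mul]
  exact mul_le_of_le_one_right (abs_nonneg _) (abs_saw_le_one _)

theorem wienerBound_invCotSum (b : ℕ) [NeZero b] :
    WienerBound b (fun s => (invCotSum b s : ℂ))
      ((1 + Real.log b) * (5 + 2 * Real.log b)) := by
  have : 0 ≤ Real.log b := Real.log_natCast_nonneg b
  have hsum : (fun s => (invCotSum b s : ℂ)) = ∑ m ∈ Finset.Ico 1 ((b + 1) / 2),
      (cotWeight b m : ℂ) • fun s : ZMod b => (sawMod b (m * s) : ℂ) := by
    ext s
    simp [invCotSum]
  rw [hsum]
  refine (WienerBound.sum _ fun (m : ℕ) _ =>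
    ((wienerBound_sawMod b).comp_mul (m : ZMod b)).smul _).mono ?_
  simp only [Complex.norm_real, Real.norm_eq_abs, ← Finset.sum_mul]
  gcongr
  exact sum_cotWeight_le b

theorem sum_range_invCotSum_eq (b K : ℕ) [NeZero b] :
    ∑ s ∈ Finset.range K, invCotSum b (s : ZMod b) =
      ∑ m ∈ Finset.Ico 1 ((b + 1) / 2),
        cotWeight b m * ∑ s ∈ Finset.range K, saw (s * ((m : ℝ) / b)) := by
  simp only [invCotSum, Finset.mul_sum]
  rw [Finset.sum_comm]
  refine Finset.sum_congr rfl fun m _ => Finset.sum_congr rfl fun s _ => ?_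
  rw [← Nat.cast_mul, sawMod_natCast, Nat.cast_mul, mul_comm (m : ℝ), mul_div_assoc]

theorem le_cotWeight_mul_sum_saw_of_lt {b K M m : ℕ} (hm : 0 < m) (hmM : m < M) (hmb : 2 * m < b)
    (hKM : K * M ≤ b) :
    (K : ℝ) * (1 / m - 1 / M - 5 * M / (b : ℝ) ^ 2) ≤
      cotWeight b m * ∑ s ∈ Finset.range K, saw (s * ((m : ℝ) / b)) := by
  have hm' : (0 : ℝ) < m := by exact_mod_cast hm
  have hmM' : (m : ℝ) < M := by exact_mod_cast hmM
  have hM' : (0 : ℝ) < M := hm'.trans hmM'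
  have hb' : (0 : ℝ) < b := by exact_mod_cast (by omega : 0 < b)
  have hmb' : (m : ℝ) / b < 1 := (div_lt_one hb').mpr (by exact_mod_cast (by omega : m < b))
  have hratio : (m : ℝ) / M < 1 := (div_lt_one hM').mpr hmM'
  have hKm : (K : ℝ) * (m / b) ≤ m / M := by
    have hKM' : (K : ℝ) * M ≤ b := by exact_mod_cast hKM
    rw [← mul_div_assoc, div_le_div_iff₀ hb' hM']
    nlinarith
  calc (K : ℝ) * (1 / m - 1 / M - 5 * M / (b : ℝ) ^ 2)
      ≤ K * (1 / m - 1 / M - 5 * m / (b : ℝ) ^ 2 * (1 - m / M)) := by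
        have hle : 5 * (m : ℝ) / (b : ℝ) ^ 2 * (1 - m / M) ≤ 5 * M / (b : ℝ) ^ 2 := by
          refine (mul_le_of_le_one_right (by positivity) (sub_le_self 1 (by positivity))).trans ?_
          gcongr
        gcongr
    _ = (1 / (m : ℝ) - 5 * m / (b : ℝ) ^ 2) * (K * (1 - m / M)) := by field_simp
    _ ≤ cotWeight b m * (K * (1 - K * (m / b))) := by
        refine mul_le_mul (le_cotWeight hm hmb) (by gcongr) ?_ (cotWeight_nonneg hm hmb)
        exact mul_nonneg K.cast_nonneg (sub_nonneg.mpr hratio.le)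
    _ ≤ cotWeight b m * ∑ s ∈ Finset.range K, saw (s * ((m : ℝ) / b)) := by
        gcongr
        · exact cotWeight_nonneg hm hmb
        · exact mul_one_sub_mul_le_sum_saw (by positivity) hmb' (hKm.trans_lt hratio)

theorem neg_div_le_cotWeight_mul_sum_saw {b m : ℕ} (hm : 0 < m) (hmb : 2 * m < b) (K : ℕ) :
    -((K : ℝ) / b) ≤ cotWeight b m * ∑ s ∈ Finset.range K, saw (s * ((m : ℝ) / b)) := by
  have : (0 : ℝ) < m := by exact_mod_cast hm
  have hb' : (0 : ℝ) < b := by exact_mod_cast (by omega : 0 < b)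
  have hmb' : (m : ℝ) / b < 1 := (div_lt_one hb').mpr (by exact_mod_cast (by omega : m < b))
  calc -((K : ℝ) / b) = -(1 / m * (K * (m / b))) := by field_simp
    _ ≤ -(cotWeight b m * (K * (m / b))) := by
        gcongr
        exact cotWeight_le hm hmb
    _ = cotWeight b m * -(K * (m / b)) := by ring
    _ ≤ cotWeight b m * ∑ s ∈ Finset.range K, saw (s * ((m : ℝ) / b)) := by
        gcongr
        · exact cotWeight_nonneg hm hmb
        · exact neg_mul_le_sum_saw (by positivity) hmb' K

theorem mul_log_sub_le_sum_Ico {b M K : ℕ} (hM : 0 < M) (hMb : 4 * M ≤ b) :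
    (K : ℝ) * (Real.log M - 3 / 2) ≤
      ∑ m ∈ Finset.Ico 1 M, (K : ℝ) * (1 / m - 1 / M - 5 * M / (b : ℝ) ^ 2) := by
  have hM' : (0 : ℝ) < M := by exact_mod_cast hM
  have hMb' : 4 * (M : ℝ) ≤ b := by exact_mod_cast hMb
  have hlog : Real.log M ≤ ∑ m ∈ Finset.Ico 1 M, 1 / (m : ℝ) + 1 / M := by
    have h := log_le_sum_inv M
    rw [show Finset.Ioc 0 M = Finset.Ico 1 (M + 1) from rfl, Finset.sum_Ico_succ_top hM] at h
    simpa only [one_div] using h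
  have hpred : ((M - 1 : ℕ) : ℝ) = M - 1 := Nat.cast_pred hM
  have hone : ((M : ℝ) - 1) * (1 / M) = 1 - 1 / M := by field_simp
  have herr : ((M : ℝ) - 1) * (5 * M / (b : ℝ) ^ 2) ≤ 1 / 2 := by
    rw [← mul_div_assoc, div_le_div_iff₀ (by nlinarith) two_pos]
    nlinarith
  rw [← Finset.mul_sum, Finset.sum_sub_distrib, Finset.sum_sub_distrib, Finset.sum_const,
    Finset.sum_const, Nat.card_Ico, nsmul_eq_mul, nsmul_eq_mul, hpred, hone]
  exact mul_le_mul_of_nonneg_left (by linarith) K.cast_nonneg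

theorem mul_log_sub_two_le_sum_invCotSum {b M K : ℕ} [NeZero b] (hM : 0 < M) (hMb : 4 * M ≤ b)
    (hKM : K * M ≤ b) :
    (K : ℝ) * (Real.log M - 2) ≤ ∑ s ∈ Finset.range K, invCotSum b (s : ZMod b) := by
  have hb : (0 : ℝ) < b := by exact_mod_cast NeZero.pos b
  have hlarge : -((K : ℝ) / 2) ≤ ∑ _m ∈ Finset.Ico M ((b + 1) / 2), -((K : ℝ) / b) := by
    have hcount : (((b + 1) / 2 - M : ℕ) : ℝ) ≤ b / 2 := by
      rw [le_div_iff₀ two_pos]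
      exact_mod_cast (by omega : ((b + 1) / 2 - M) * 2 ≤ b)
    rw [Finset.sum_const, Nat.card_Ico, nsmul_eq_mul, mul_neg, neg_le_neg_iff]
    calc (((b + 1) / 2 - M : ℕ) : ℝ) * (K / b) ≤ b / 2 * (K / b) := by gcongr
      _ = K / 2 := by field_simp
  rw [sum_range_invCotSum_eq, ← Finset.sum_Ico_consecutive _ hM (by omega : M ≤ (b + 1) / 2)]
  calc (K : ℝ) * (Real.log M - 2) = K * (Real.log M - 3 / 2) + -(K / 2) := by ring
    _ ≤ ∑ m ∈ Finset.Ico 1 M, (K : ℝ) * (1 / m - 1 / M - 5 * M / (b : ℝ) ^ 2) +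
          ∑ _m ∈ Finset.Ico M ((b + 1) / 2), -((K : ℝ) / b) :=
        add_le_add (mul_log_sub_le_sum_Ico hM hMb) hlarge
    _ ≤ _ := by
        refine add_le_add (Finset.sum_le_sum fun m hm => ?_) (Finset.sum_le_sum fun m hm => ?_)
        · rw [Finset.mem_Ico] at hm
          exact le_cotWeight_mul_sum_saw_of_lt hm.1 hm.2 (by omega) hKM
        · rw [Finset.mem_Ico] at hm
          exact neg_div_le_cotWeight_mul_sum_saw (by omega) (by omega) K

theorem mem_coprimeRange {b r : ℕ} : r ∈ coprimeRange b ↔ r < b ∧ r.Coprime b := by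
  rw [coprimeRange, Finset.mem_filter, Finset.mem_range]

theorem sum_coprimeRange_inv {E : Type*} [AddCommMonoid E] (b : ℕ) [NeZero b] (φ : ZMod b → E) :
    ∑ r ∈ coprimeRange b, φ (r : ZMod b)⁻¹ = ∑ r ∈ coprimeRange b, φ r := by
  have hmem : ∀ r ∈ coprimeRange b, ((r : ZMod b)⁻¹).val ∈ coprimeRange b := by
    intro r hr
    rw [mem_coprimeRange] at hr ⊢
    refine ⟨ZMod.val_lt _, ?_⟩
    rw [← ZMod.isUnit_iff_coprime, ZMod.natCast_zmod_val]
    exact IsUnit.of_mul_eq_one_right _ (ZMod.coe_mul_inv_eq_one r hr.2)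
  have hinv : ∀ r ∈ coprimeRange b, ((((r : ZMod b)⁻¹).val : ZMod b)⁻¹).val = r := by
    intro r hr
    rw [mem_coprimeRange] at hr
    have hunit := (mul_comm _ _).trans (ZMod.coe_mul_inv_eq_one r hr.2)
    rw [ZMod.natCast_zmod_val, ZMod.inv_eq_of_mul_eq_one b _ _ hunit, ZMod.val_cast_of_lt hr.1]
  refine Finset.sum_bij' (fun r _ => ((r : ZMod b)⁻¹).val) (fun r _ => ((r : ZMod b)⁻¹).val)
    hmem hmem hinv hinv fun r _ => ?_
  rw [ZMod.natCast_zmod_val]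

theorem residues_eq_filter_coprimeRange (A₀ A₁ : ℝ) {b : ℕ} (hb : b ≠ 1) :
    residues A₀ A₁ b = (coprimeRange b).filter fun r : ℕ => A₀ * b ≤ r ∧ (r : ℝ) ≤ A₁ * b := by
  ext r
  simp only [residues, coprimeRange, Finset.mem_filter, Finset.mem_range, and_assoc]
  refine and_congr_left fun ⟨hcop, _⟩ =>
    ⟨fun h => (Nat.lt_succ_iff.mp h).lt_of_ne ?_, Nat.lt_succ_of_lt⟩
  rintro rfl
  exact hb ((Nat.coprime_self r).mp hcop)

theorem abs_sum_residues_sub_le {A₀ A₁ : ℝ} (h0 : 0 ≤ A₀) (h01 : A₀ ≤ A₁) (h1 : A₁ ≤ 1) {q : ℕ}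
    [Fact q.Prime] {φ : ZMod (q ^ 2) → ℝ} {C : ℝ}
    (hφ : WienerBound (q ^ 2) (fun s => (φ s : ℂ)) C) :
    |∑ r ∈ residues A₀ A₁ (q ^ 2), φ (r : ZMod (q ^ 2))⁻¹ -
      (A₁ - A₀) * ∑ s ∈ coprimeRange (q ^ 2), φ s| ≤ C * (3 * q * (1 + Real.log q)) := by
  have hb : q ^ 2 ≠ 1 := (Nat.one_lt_pow two_ne_zero (Fact.out : q.Prime).one_lt).ne'
  let T : (ZMod (q ^ 2) → ℂ) →ₗ[ℂ] ℂ := ∑ r ∈ coprimeRange (q ^ 2),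
    (balancedWeight A₀ A₁ (q ^ 2) r : ℂ) • LinearMap.proj ((r : ZMod (q ^ 2))⁻¹)
  have hT : ∀ f, T f = ∑ r ∈ coprimeRange (q ^ 2), (balancedWeight A₀ A₁ (q ^ 2) r : ℂ) *
      f ((r : ZMod (q ^ 2))⁻¹) := fun f => by simp [T]
  have hTφ : T (fun s => (φ s : ℂ)) = ((∑ r ∈ residues A₀ A₁ (q ^ 2), φ (r : ZMod (q ^ 2))⁻¹ -
      (A₁ - A₀) * ∑ s ∈ coprimeRange (q ^ 2), φ s : ℝ) : ℂ) := by
    rw [hT, residues_eq_filter_coprimeRange A₀ A₁ hb, Finset.sum_filter,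
      ← sum_coprimeRange_inv, Finset.mul_sum, ← Finset.sum_sub_distrib, Complex.ofReal_sum]
    refine Finset.sum_congr rfl fun r _ => ?_
    rw [balancedWeight, ← Complex.ofReal_mul, sub_mul, ite_mul, one_mul, zero_mul]
  rw [← Real.norm_eq_abs, ← Complex.norm_real, ← hTφ]
  refine hφ T _ fun u => ?_
  rw [hT]
  exact norm_sum_balancedWeight_le h0 h01 h1 u

theorem card_filter_not_coprime_sq {q : ℕ} (hq : q.Prime) :
    ((Finset.range (q ^ 2)).filter fun s => ¬s.Coprime (q ^ 2)).card = q := by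
  have htotient : ((Finset.range (q ^ 2)).filter fun s => s.Coprime (q ^ 2)).card =
      q * (q - 1) := by
    simp only [Nat.coprime_comm (m := q ^ 2), ← Nat.totient_eq_card_coprime]
    rw [Nat.totient_prime_pow_succ hq 1, pow_one]
  have hsplit := Finset.card_filter_add_card_filter_not (s := Finset.range (q ^ 2))
    fun s => s.Coprime (q ^ 2)
  obtain ⟨p, rfl⟩ := Nat.exists_eq_succ_of_ne_zero hq.ne_zero
  rw [htotient, Finset.card_range, Nat.add_one_sub_one] at hsplit
  linarith

theorem sum_range_sub_le_sum_coprime {q K : ℕ} (hq : q.Prime) (hK : K ≤ q ^ 2) {ψ : ℕ → ℝ} {D : ℝ}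
    (hD : 0 ≤ D) (hψ : ∀ s, ψ s ≤ D) :
    ∑ s ∈ Finset.range K, ψ s - q * D ≤ ∑ s ∈ (coprimeRange (q ^ 2)).filter (· < K), ψ s := by
  have hcoprime : (coprimeRange (q ^ 2)).filter (· < K) =
      (Finset.range K).filter fun s => s.Coprime (q ^ 2) := by
    ext s
    simp only [Finset.mem_filter, mem_coprimeRange, Finset.mem_range]
    exact ⟨fun h => ⟨h.2, h.1.2⟩, fun h => ⟨⟨h.1.trans_le hK, h.2⟩, h.1⟩⟩
  have hcard : ((Finset.range K).filter fun s => ¬s.Coprime (q ^ 2)).card ≤ q :=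
    (Finset.card_le_card (Finset.filter_subset_filter _ (Finset.range_subset_range.mpr hK))).trans
      (card_filter_not_coprime_sq hq).le
  have hbound : ∑ s ∈ (Finset.range K).filter (fun s => ¬s.Coprime (q ^ 2)), ψ s ≤ q * D := by
    refine (Finset.sum_le_card_nsmul _ _ D fun s _ => hψ s).trans ?_
    rw [nsmul_eq_mul]
    gcongr
  rw [hcoprime, ← Finset.sum_filter_add_sum_filter_not (Finset.range K)
    (fun s => s.Coprime (q ^ 2)) ψ]
  linarith

/-- The residues in `[A₀ b, A₁ b]` whose inverse modulo `b` lies in `[0, K)`. At these residues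
the cotangent sum is large on average. -/
noncomputable def smallInvResidues (A₀ A₁ : ℝ) (b K : ℕ) : Finset ℕ :=
  (residues A₀ A₁ b).filter fun r => ((r : ZMod b)⁻¹).val < K

theorem wienerBound_const (b : ℕ) [NeZero b] (a : ℂ) : WienerBound b (fun _ => a) ‖a‖ := by
  have h := (WienerBound.stdAddChar_mul (0 : ZMod b)).smul a
  simpa only [zero_mul, AddChar.map_zero_eq_one, mul_one, Pi.smul_def, smul_eq_mul] using h

theorem log_natCast_sq (q : ℕ) : Real.log ((q ^ 2 : ℕ) : ℝ) = 2 * Real.log q := by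
  rw [Nat.cast_pow, Real.log_pow, Nat.cast_ofNat]

section smallInvResidues

variable {A₀ A₁ : ℝ} {q K : ℕ} [Fact q.Prime]

theorem le_sum_smallInvResidues (h0 : 0 ≤ A₀) (h01 : A₀ ≤ A₁) (h1 : A₁ ≤ 1) (hK : K ≤ q ^ 2)
    {φ : ZMod (q ^ 2) → ℝ} {C D : ℝ} (hφ : WienerBound (q ^ 2) (fun s => (φ s : ℂ)) C)
    (hD : 0 ≤ D) (hφD : ∀ s, φ s ≤ D) :
    (A₁ - A₀) * (∑ s ∈ Finset.range K, φ s - q * D) - 6 * C * q * (1 + Real.log q) ^ 2 ≤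
      ∑ r ∈ smallInvResidues A₀ A₁ (q ^ 2) K, φ (r : ZMod (q ^ 2))⁻¹ := by
  let ψ : ZMod (q ^ 2) → ℝ := fun s => if s.val < K then φ s else 0
  have hψ : WienerBound (q ^ 2) (fun s => (ψ s : ℂ)) ((2 + 2 * Real.log q) * C) := by
    have hmul : (fun s => (ψ s : ℂ)) = initialIndicator (q ^ 2) K * fun s => (φ s : ℂ) := by
      ext s
      simp only [ψ, initialIndicator, Pi.mul_apply, ite_mul, one_mul, zero_mul]
      split_ifs <;> simp
    rw [hmul, ← log_natCast_sq]
    exact (wienerBound_initialIndicator hK).mul hφ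
  have hcoprime : ∑ s ∈ Finset.range K, φ s - q * D ≤ ∑ s ∈ coprimeRange (q ^ 2), ψ s := by
    refine (sum_range_sub_le_sum_coprime Fact.out hK hD fun s => hφD s).trans ?_
    rw [Finset.sum_filter]
    refine (Finset.sum_congr rfl fun s hs => ?_).le
    simp only [ψ, ZMod.val_cast_of_lt (mem_coprimeRange.mp hs).1]
  calc (A₁ - A₀) * (∑ s ∈ Finset.range K, φ s - q * D) - 6 * C * q * (1 + Real.log q) ^ 2
      ≤ (A₁ - A₀) * ∑ s ∈ coprimeRange (q ^ 2), ψ s -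
          (2 + 2 * Real.log q) * C * (3 * q * (1 + Real.log q)) :=
        sub_le_sub (mul_le_mul_of_nonneg_left hcoprime (sub_nonneg.mpr h01)) (by linarith)
    _ ≤ ∑ r ∈ residues A₀ A₁ (q ^ 2), ψ (r : ZMod (q ^ 2))⁻¹ := by
        linarith [(abs_le.mp (abs_sum_residues_sub_le h0 h01 h1 hψ)).1]
    _ = ∑ r ∈ smallInvResidues A₀ A₁ (q ^ 2) K, φ (r : ZMod (q ^ 2))⁻¹ :=
        (Finset.sum_filter _ _).symm

theorem le_card_smallInvResidues (h0 : 0 ≤ A₀) (h01 : A₀ ≤ A₁) (h1 : A₁ ≤ 1) (hK : K ≤ q ^ 2) :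
    (A₁ - A₀) * K - 7 * q * (1 + Real.log q) ^ 2 ≤ (smallInvResidues A₀ A₁ (q ^ 2) K).card := by
  have hlog : 0 ≤ Real.log q := Real.log_natCast_nonneg q
  have hle := le_sum_smallInvResidues (φ := fun _ => 1) h0 h01 h1 hK
    (wienerBound_const (q ^ 2) ((1 : ℝ) : ℂ)) zero_le_one fun _ => le_rfl
  simp only [Finset.sum_const, Finset.card_range, nsmul_eq_mul, mul_one, Complex.ofReal_one,
    norm_one] at hle
  have hq : (A₁ - A₀) * q ≤ q * (1 + Real.log q) ^ 2 := by
    rw [mul_comm (A₁ - A₀)]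
    gcongr
    nlinarith
  linarith

theorem card_mul_le_sum_invCotSum {c : ℝ} (h0 : 0 ≤ A₀) (h01 : A₀ ≤ A₁) (h1 : A₁ ≤ 1)
    (hK : K ≤ q ^ 2) (hc : 0 ≤ c)
    (hmean : K * (c + 1) ≤ ∑ s ∈ Finset.range K, invCotSum (q ^ 2) s)
    (hlarge : (62 + 6 * c) * (1 + Real.log q) ^ 4 * q ≤ (A₁ - A₀) * K) :
    (smallInvResidues A₀ A₁ (q ^ 2) K).card * c ≤
      ∑ r ∈ smallInvResidues A₀ A₁ (q ^ 2) K, invCotSum (q ^ 2) (r : ZMod (q ^ 2))⁻¹ := by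
  set G := 1 + Real.log q
  have hG1 : 1 ≤ G := le_add_of_nonneg_right (Real.log_natCast_nonneg q)
  have hbound : WienerBound (q ^ 2) (fun s => ((invCotSum (q ^ 2) s - c : ℝ) : ℂ))
      (10 * G ^ 2 + c) := by
    have hsub : (fun s => ((invCotSum (q ^ 2) s - c : ℝ) : ℂ)) =
        (fun s => (invCotSum (q ^ 2) s : ℂ)) + fun _ => ((-c : ℝ) : ℂ) := by
      ext s
      simp [sub_eq_add_neg]
    rw [hsub]
    refine ((wienerBound_invCotSum (q ^ 2)).add (wienerBound_const (q ^ 2) _)).mono ?_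
    rw [Complex.norm_real, norm_neg, Real.norm_of_nonneg hc, log_natCast_sq]
    nlinarith
  have hle := le_sum_smallInvResidues h0 h01 h1 hK hbound (D := 2 * G) (by positivity) fun s => by
    linarith [invCotSum_le s, log_natCast_sq q]
  simp only [Finset.sum_sub_distrib, Finset.sum_const, Finset.card_range, nsmul_eq_mul] at hle
  have hmain : (A₁ - A₀) * (K - q * (2 * G)) ≤
      (A₁ - A₀) * (∑ s ∈ Finset.range K, invCotSum (q ^ 2) s - K * c - q * (2 * G)) :=
    mul_le_mul_of_nonneg_left (by linarith) (sub_nonneg.mpr h01)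
  have hnoncoprime : (A₁ - A₀) * (q * (2 * G)) ≤ 2 * G ^ 4 * q := by
    have hG4 : G ≤ G ^ 4 := le_self_pow₀ hG1 four_ne_zero
    calc (A₁ - A₀) * (q * (2 * G)) ≤ 1 * (q * (2 * G ^ 4)) := by
          gcongr
          linarith
      _ = 2 * G ^ 4 * q := by ring
  have htransfer : 6 * (10 * G ^ 2 + c) * q * G ^ 2 ≤ (60 + 6 * c) * G ^ 4 * q := by
    have hG2 : G ^ 2 ≤ G ^ 4 := pow_le_pow_right₀ hG1 (by norm_num)
    calc 6 * (10 * G ^ 2 + c) * q * G ^ 2 = 60 * G ^ 4 * q + 6 * c * G ^ 2 * q := by ring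
      _ ≤ 60 * G ^ 4 * q + 6 * c * G ^ 4 * q := by gcongr
      _ = (60 + 6 * c) * G ^ 4 * q := by ring
  linarith

theorem le_sum_residues_invCotSum_pow {c : ℝ} (h0 : 0 ≤ A₀) (h01 : A₀ ≤ A₁) (h1 : A₁ ≤ 1)
    (hK : K ≤ q ^ 2) (hc : 0 ≤ c)
    (hmean : K * (c + 1) ≤ ∑ s ∈ Finset.range K, invCotSum (q ^ 2) s)
    (hlarge : (62 + 6 * c) * (1 + Real.log q) ^ 4 * q ≤ (A₁ - A₀) * K / 2) {n : ℕ} (hn : Even n) :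
    (A₁ - A₀) * K / 2 * c ^ n ≤
      ∑ r ∈ residues A₀ A₁ (q ^ 2), invCotSum (q ^ 2) (r : ZMod (q ^ 2))⁻¹ ^ n := by
  have hlog : 0 ≤ Real.log q := Real.log_natCast_nonneg q
  have herror : 7 * q * (1 + Real.log q) ^ 2 ≤ (A₁ - A₀) * K / 2 := by
    refine le_trans ?_ hlarge
    calc 7 * q * (1 + Real.log q) ^ 2 = 7 * (1 + Real.log q) ^ 2 * q := by ring
      _ ≤ (62 + 6 * c) * (1 + Real.log q) ^ 4 * q := by
          gcongr <;> linarith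
  have hcard := le_card_smallInvResidues h0 h01 h1 hK
  calc (A₁ - A₀) * K / 2 * c ^ n ≤ (smallInvResidues A₀ A₁ (q ^ 2) K).card * c ^ n := by
        gcongr
        linarith
    _ ≤ ∑ r ∈ smallInvResidues A₀ A₁ (q ^ 2) K, invCotSum (q ^ 2) (r : ZMod (q ^ 2))⁻¹ ^ n := by
        refine card_mul_pow_le_sum_pow hc (card_mul_le_sum_invCotSum h0 h01 h1 hK hc hmean ?_) hn
        have : 0 ≤ A₁ - A₀ := sub_nonneg.mpr h01
        exact hlarge.trans (half_le_self (by positivity))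
    _ ≤ _ := Finset.sum_le_sum_of_subset_of_nonneg (Finset.filter_subset _ _)
        fun _ _ _ => hn.pow_nonneg _

end smallInvResidues

theorem normalizedMoment_eq (A₀ A₁ : ℝ) (k b : ℕ) [NeZero b] :
    normalizedMoment A₀ A₁ k b = (b.totient : ℝ)⁻¹ * (A₁ - A₀)⁻¹ *
      ((∑ r ∈ residues A₀ A₁ b, invCotSum b (r : ZMod b)⁻¹ ^ (2 * k)) / Real.pi ^ (2 * k)) := by
  have hb : (b : ℝ) ≠ 0 := NeZero.ne _
  have hpow : ∀ r ∈ residues A₀ A₁ b, cotSum r b ^ (2 * k) =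
      (b : ℝ) ^ (2 * k) * (invCotSum b (r : ZMod b)⁻¹ ^ (2 * k) / Real.pi ^ (2 * k)) := by
    intro r hr
    rw [cotSum_eq_invCotSum (Finset.mem_filter.mp hr).2.1, mul_pow, div_pow]
    ring
  rw [normalizedMoment, Finset.sum_congr rfl hpow, ← Finset.mul_sum, ← Finset.sum_div]
  field_simp

theorem div_two_mul_le_natCast_div {b M : ℕ} (hM : 0 < M) (hMb : M ≤ b) :
    (b : ℝ) / (2 * M) ≤ (b / M : ℕ) := by
  have hpos : 0 < b / M := Nat.div_pos hMb hM
  have hlt : b < M * (b / M + 1) := Nat.lt_mul_div_succ b hM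
  have hle : b ≤ b / M * (2 * M) := by nlinarith
  rw [div_le_iff₀ (by positivity)]
  exact_mod_cast hle

theorem le_normalizedMoment_sq {A₀ A₁ : ℝ} (h0 : 0 ≤ A₀) (h01 : A₀ < A₁) (h1 : A₁ ≤ 1)
    {q M : ℕ} [Fact q.Prime] (k : ℕ) (hM : 3 < Real.log M) (hMb : 4 * M ≤ q ^ 2)
    (hlarge : (62 + 6 * (Real.log M - 3)) * (4 * M) * (1 + Real.log q) ^ 4 ≤ (A₁ - A₀) * q) :
    ((Real.log M - 3) / Real.pi) ^ (2 * k) / (4 * M) ≤ normalizedMoment A₀ A₁ k (q ^ 2) := by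
  have hM0 : 0 < M := pos_of_log_natCast_pos (by linarith)
  have hlam : 0 < A₁ - A₀ := sub_pos.mpr h01
  have hK : (q : ℝ) ^ 2 / (2 * M) ≤ (q ^ 2 / M : ℕ) := by
    exact_mod_cast div_two_mul_le_natCast_div hM0 (by omega : M ≤ q ^ 2)
  have hmean := mul_log_sub_two_le_sum_invCotSum hM0 hMb (Nat.div_mul_le_self (q ^ 2) M)
  have herror : (62 + 6 * (Real.log M - 3)) * (1 + Real.log q) ^ 4 * q ≤
      (A₁ - A₀) * (q ^ 2 / M : ℕ) / 2 :=
    calc (62 + 6 * (Real.log M - 3)) * (1 + Real.log q) ^ 4 * q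
        = (62 + 6 * (Real.log M - 3)) * (4 * M) * (1 + Real.log q) ^ 4 * (q / (4 * M)) := by
          field_simp
      _ ≤ (A₁ - A₀) * q * (q / (4 * M)) := by gcongr
      _ = (A₁ - A₀) * (q ^ 2 / (2 * M)) / 2 := by field_simp; ring
      _ ≤ (A₁ - A₀) * (q ^ 2 / M : ℕ) / 2 := by gcongr
  have hsum := le_sum_residues_invCotSum_pow h0 h01.le h1 (Nat.div_le_self (q ^ 2) M)
    (sub_pos.mpr hM).le (by linarith) herror (even_two_mul k)
  have htotient : ((q ^ 2).totient : ℝ) ≤ (q : ℝ) ^ 2 := by exact_mod_cast Nat.totient_le (q ^ 2)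
  have htotient0 : (0 : ℝ) < (q ^ 2).totient := by
    exact_mod_cast Nat.totient_pos.mpr (NeZero.pos (q ^ 2))
  have hc : 0 < Real.log M - 3 := sub_pos.mpr hM
  rw [normalizedMoment_eq]
  calc ((Real.log M - 3) / Real.pi) ^ (2 * k) / (4 * M)
      = ((q : ℝ) ^ 2)⁻¹ * (A₁ - A₀)⁻¹ * ((A₁ - A₀) * (q ^ 2 / (2 * M)) / 2 *
          (Real.log M - 3) ^ (2 * k) / Real.pi ^ (2 * k)) := by
        rw [div_pow]
        field_simp
        norm_num
    _ ≤ ((q ^ 2).totient : ℝ)⁻¹ * (A₁ - A₀)⁻¹ * ((A₁ - A₀) * (q ^ 2 / M : ℕ) / 2 *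
          (Real.log M - 3) ^ (2 * k) / Real.pi ^ (2 * k)) := by gcongr
    _ ≤ _ := by gcongr

theorem eventually_mul_one_add_log_pow_le {C lam : ℝ} (hC : 0 < C) (hlam : 0 < lam) (n : ℕ) :
    ∀ᶠ q : ℕ in atTop, C * (1 + Real.log q) ^ n ≤ lam * q := by
  have hscale : Tendsto (fun q : ℕ => Real.exp 1 * (q : ℝ)) atTop atTop :=
    tendsto_natCast_atTop_atTop.const_mul_atTop (Real.exp_pos 1)
  have hlittle := (Real.isLittleO_pow_log_id_atTop (n := n)).comp_tendsto hscale
  filter_upwards [hlittle.def (c := lam / (C * Real.exp 1)) (by positivity),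
    eventually_gt_atTop 0] with q hq hq0
  have hq0' : (0 : ℝ) < q := by exact_mod_cast hq0
  rw [Function.comp_apply, Function.comp_apply, id, Real.log_mul (Real.exp_pos 1).ne' hq0'.ne',
    Real.log_exp, Real.norm_of_nonneg (by positivity : 0 ≤ Real.exp 1 * (q : ℝ))] at hq
  calc C * (1 + Real.log q) ^ n ≤ C * (lam / (C * Real.exp 1) * (Real.exp 1 * q)) :=
        mul_le_mul_of_nonneg_left ((le_abs_self _).trans hq) hC.le
    _ = lam * q := by field_simp

theorem IsLimitMoments.hasLogLowerBound {A₀ A₁ : ℝ} (h0 : 0 ≤ A₀) (h01 : A₀ < A₁) (h1 : A₁ ≤ 1)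
    {H : ℕ → ℝ} (hH : IsLimitMoments A₀ A₁ H) : HasLogLowerBound H := by
  intro k M hM
  have hM0 : (0 : ℝ) < M := Nat.cast_pos.mpr (pos_of_log_natCast_pos (by linarith))
  have hconst : 0 < (62 + 6 * (Real.log M - 3)) * (4 * M) := mul_pos (by linarith) (by linarith)
  have hsq : Tendsto (fun q : ℕ => q ^ 2) atTop atTop := tendsto_pow_atTop two_ne_zero
  have hprimes : ∃ᶠ q : ℕ in atTop, q.Prime :=
    Nat.frequently_atTop_iff_infinite.mpr Nat.infinite_setOfPred_prime
  have hlarge := (hsq.eventually_ge_atTop (4 * M)).and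
    (eventually_mul_one_add_log_pow_le hconst (sub_pos.mpr h01) 4)
  refine ge_of_tendsto_of_frequently ((hH k).comp hsq) ?_
  refine (hprimes.and_eventually hlarge).mono fun q ⟨hq, hMb, hlog⟩ => ?_
  have : Fact q.Prime := ⟨hq⟩
  exact le_normalizedMoment_sq h0 h01 h1 k hM hMb hlog

end CotangentMoments

theorem theorem2_general :
    ((∀ x : ℂ, Real.pi ^ 2 < ‖x‖ →
        CotangentMoments.SeriesDiverges CotangentMoments.integralMoment x) ∧
      CotangentMoments.seriesRadius CotangentMoments.integralMoment
        ≤ ENNReal.ofReal (Real.pi ^ 2)) ∧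
    ∀ A₀ A₁ : ℝ, 0 ≤ A₀ → A₀ < A₁ → A₁ ≤ 1 →
      ∀ H : ℕ → ℝ, CotangentMoments.IsLimitMoments A₀ A₁ H →
        (∀ x : ℂ, Real.pi ^ 2 < ‖x‖ → CotangentMoments.SeriesDiverges H x) ∧
          CotangentMoments.seriesRadius H ≤ ENNReal.ofReal (Real.pi ^ 2) := by
  have hdiv : ∀ {H}, CotangentMoments.HasLogLowerBound H →
      (∀ x : ℂ, Real.pi ^ 2 < ‖x‖ → CotangentMoments.SeriesDiverges H x) ∧
        CotangentMoments.seriesRadius H ≤ ENNReal.ofReal (Real.pi ^ 2) :=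
    fun hH => ⟨fun _ hx => hH.seriesDiverges hx, hH.seriesRadius_le⟩
  exact ⟨hdiv CotangentMoments.hasLogLowerBound_integralMoment,
    fun _ _ h0 h01 h1 _ hH => hdiv (hH.hasLogLowerBound h0 h01 h1)⟩

theorem theorem2 :
    ((∀ x : ℂ, Real.pi ^ 2 < ‖x‖ →
        CotangentMoments.SeriesDiverges CotangentMoments.integralMoment x) ∧
      CotangentMoments.seriesRadius CotangentMoments.integralMoment
        ≤ ENNReal.ofReal (Real.pi ^ 2)) ∧
    ∀ A₀ A₁ : ℝ, 1 / 2 < A₀ → A₀ < A₁ → A₁ < 1 →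
      ∀ H : ℕ → ℝ, CotangentMoments.IsLimitMoments A₀ A₁ H →
        (∀ x : ℂ, Real.pi ^ 2 < ‖x‖ → CotangentMoments.SeriesDiverges H x) ∧
          CotangentMoments.seriesRadius H ≤ ENNReal.ofReal (Real.pi ^ 2) :=
  ⟨theorem2_general.1, fun A₀ A₁ h0 h01 h1 =>
    theorem2_general.2 A₀ A₁ (one_half_pos.trans h0).le h01 h1.le⟩
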